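/- For complex $x,q$ with $|q|<1$ write $(x;q)_n=\prod_{i=0}^{n-1}(1-xq^i)$ and $(x;q)_\infty=\prod_{i=0}^{\infty}(1-xq^i)$, and let $(x_1,\dots,x_m;q)_n=(x_1;q)_n\cdots(x_m;q)_n$, also for $n=\infty$. Let $q,a,b$ be nonzero complex numbers with $|q|<1$, such that $aq^{n}\neq 1$ and $b\neq q^{n}$ for all integers $n\ge 1$ (so that no denominator below vanishes). Then all series below converge absolutely (the double series as a series over pairs $(n,k)$), and \begin{multline*} \sum_{n=0}^\infty \frac{(aq/b;q)_{2n}\,q^n}{(q,aq,q/b;q)_n} =\frac{(b;q)_\infty}{(aq;q)_\infty} \sum_{n=0}^\infty \frac{(aq/b;q)_n\,a^nq^{n^2+n}}{(q;q)_n}\\ +\frac{(aq/b;q)_\infty}{(q,q/b;q)_\infty} \sum_{n=0}^\infty \sum_{k=0}^\infty \frac{(-1)^k(bq^{-n}/a;q)_k\, a^{n+k} b^{k+1} q^{n^2+n+nk+3k(k+1)/2}(1-bq^{2k+1})} {(q;q)_n(aq;q)_{n+k+1}}. \end{multline*} When $b=a$, this reduces to Ramanujan's identity \[ \sum_{n=0}^\infty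 \frac{(q^{n+1};q)_n\, q^n}{(aq,q/a;q)_n} =(1-a)\sum_{n=0}^\infty a^n q^{n^2+n}+ \frac{a}{(aq,q/a;q)_\infty} \sum_{n=0}^\infty a^{3n}q^{n(3n+2)}(1-aq^{2n+1}), \] in the sense that the summands on the left agree for every $n$, and the first and the second term on the right of the first identity equal, respectively, the first and the second term on the right of the second one. -/

import Mathlib

/-- The finite `q`-shifted factorial `(a;q)_n = (1 - a)(1 - aq)⋯(1 - aq^(n-1))`, equal to `1`
for `n = 0`. -/
def qPoch (a q : ℂ) (n : ℕ) : ℂ := ∏ i ∈ Finset.range n, (1 - a * q ^ i)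

/-- The infinite `q`-shifted factorial `(a;q)_∞ = ∏_{n ≥ 0} (1 - aq^n)`, used for `‖q‖ < 1`. -/
noncomputable def qPochInf (a q : ℂ) : ℂ := ∏' n : ℕ, (1 - a * q ^ n)

/-- For `‖q‖ < 1` the product that defines `(a;q)_∞` converges, so `qPochInf` is its value. -/
theorem hasProd_qPochInf (a : ℂ) {q : ℂ} (hq : ‖q‖ < 1) :
    HasProd (fun n : ℕ => 1 - a * q ^ n) (qPochInf a q) := by
  have hs : Summable (fun n : ℕ => ‖-(a * q ^ n)‖) := by
    simpa [norm_mul, norm_pow] using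
      (summable_geometric_of_lt_one (norm_nonneg q) hq).mul_left ‖a‖
  have h := multipliable_one_add_of_summable hs
  simpa [qPochInf, sub_eq_add_neg] using h.hasProd

open Filter Topology

/-! Put `c = aq/b`, multiply the left side by `(aq, c/a; q)_∞` and call the result `L`. The bridge
is `Φ(s) = qPhi a q s`, which has a second form when `s z = q²` and `|z| < 1`
(`qPhi_eq_qPochInf_mul_tsum`).

Suppose `0 < |c| < 1`. The `q`-binomial theorem expands `(c;q)_{2n} (cq^n/a;q)_∞ / (c;q)_∞` in
powers of `cq^{2n}`. After interchanging sums, the sum over `n` is the second form of `Φ(q^{1-y})`,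
so `L (q;q)_∞ / (c;q)_∞` is the half `y ≥ 0` of the bilateral series `∑ (-1)^y q^{y(y-1)/2} (c/a)^y
Φ(q^{1-y})` (`qPochInf_mul_tsum_eq_tsum_qTri_mul_qPhi`). The whole series over `ℤ` is evaluated
termwise by a degenerate Ramanujan summation, a consequence of the Jacobi triple product, and gives
the first term on the right (`tsum_qTriInt_mul_qPhi`). The half `y < 0` is minus a power series in
`b`, `residualSeries`, which a limiting Rogers–Fine identity turns into `(aq;q)_∞` times the double
series (`qPochInf_mul_tsum_doubleTerm`).

Both sides of the cleared identity are analytic in `c ≠ 0`, so the restriction `|c| < 1` disappears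
(`three_term`).

For `b = a` the factor `(q^{-n};q)_k` kills the terms with `n < k`, and the sum over `n ≥ k` is
evaluated by Cauchy's identity `tsum_pow_sq_mul_qPochInf`. -/

/-! ### Finite and infinite `q`-shifted factorials. -/

theorem qPoch_zero (x q : ℂ) : qPoch x q 0 = 1 := by simp [qPoch]

theorem qPoch_succ (x q : ℂ) (n : ℕ) : qPoch x q (n + 1) = qPoch x q n * (1 - x * q ^ n) := by
  simp [qPoch, Finset.prod_range_succ]

theorem qPoch_add (x q : ℂ) (n m : ℕ) :
    qPoch x q (n + m) = qPoch x q n * qPoch (x * q ^ n) q m := by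
  simp [qPoch, Finset.prod_range_add, pow_add, mul_assoc]

theorem qPoch_succ' (x q : ℂ) (n : ℕ) : qPoch x q (n + 1) = (1 - x) * qPoch (x * q) q n := by
  rw [add_comm, qPoch_add]
  simp [qPoch]

theorem qPoch_ne_zero {x q : ℂ} (h : ∀ n : ℕ, x * q ^ n ≠ 1) (n : ℕ) : qPoch x q n ≠ 0 :=
  Finset.prod_ne_zero_iff.2 fun i _ => sub_ne_zero.2 (h i).symm

theorem mul_pow_ne_one_of_norm_lt_one {z q : ℂ} (hz : ‖z‖ < 1) (hq : ‖q‖ < 1) (n : ℕ) :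
    z * q ^ n ≠ 1 := by
  intro h
  have h1 : ‖z * q ^ n‖ = 1 := by rw [h, norm_one]
  rw [norm_mul, norm_pow] at h1
  have h2 : ‖q‖ ^ n ≤ 1 := pow_le_one₀ (norm_nonneg q) hq.le
  nlinarith [norm_nonneg z, norm_nonneg q]

theorem qPoch_self_ne_zero {q : ℂ} (hq : ‖q‖ < 1) (n : ℕ) : qPoch q q n ≠ 0 :=
  qPoch_ne_zero (mul_pow_ne_one_of_norm_lt_one hq hq) n

theorem norm_qPoch_le (x : ℂ) {q : ℂ} (hq : ‖q‖ < 1) (n : ℕ) :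
    ‖qPoch x q n‖ ≤ Real.exp (‖x‖ / (1 - ‖q‖)) := by
  have hs := summable_geometric_of_lt_one (norm_nonneg q) hq
  calc ‖qPoch x q n‖ = ∏ i ∈ Finset.range n, ‖1 - x * q ^ i‖ := by rw [qPoch, norm_prod]
    _ ≤ ∏ i ∈ Finset.range n, Real.exp (‖x‖ * ‖q‖ ^ i) := by
        refine Finset.prod_le_prod (fun _ _ => norm_nonneg _) fun i _ => ?_
        calc ‖1 - x * q ^ i‖ ≤ ‖(1 : ℂ)‖ + ‖x * q ^ i‖ := norm_sub_le _ _
          _ = ‖x‖ * ‖q‖ ^ i + 1 := by rw [norm_one, norm_mul, norm_pow, add_comm]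
          _ ≤ _ := Real.add_one_le_exp _
    _ = Real.exp (‖x‖ * ∑ i ∈ Finset.range n, ‖q‖ ^ i) := by rw [← Real.exp_sum, Finset.mul_sum]
    _ ≤ Real.exp (‖x‖ / (1 - ‖q‖)) := by
        rw [div_eq_mul_inv, ← tsum_geometric_of_lt_one (norm_nonneg q) hq]
        gcongr
        exact hs.sum_le_tsum _ fun i _ => by positivity

theorem tendsto_qPoch (x : ℂ) {q : ℂ} (hq : ‖q‖ < 1) :
    Tendsto (qPoch x q) atTop (𝓝 (qPochInf x q)) :=
  (hasProd_qPochInf x hq).tendsto_prod_nat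

theorem norm_qPochInf_le (x : ℂ) {q : ℂ} (hq : ‖q‖ < 1) :
    ‖qPochInf x q‖ ≤ Real.exp (‖x‖ / (1 - ‖q‖)) :=
  le_of_tendsto (tendsto_qPoch x hq).norm (Eventually.of_forall (norm_qPoch_le x hq))

theorem qPochInf_eq_qPoch_mul (x : ℂ) {q : ℂ} (hq : ‖q‖ < 1) (n : ℕ) :
    qPochInf x q = qPoch x q n * qPochInf (x * q ^ n) q := by
  refine tendsto_nhds_unique ((tendsto_add_atTop_iff_nat n).2 (tendsto_qPoch x hq)) ?_
  simp_rw [add_comm _ n, qPoch_add]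
  exact (tendsto_qPoch _ hq).const_mul _

theorem qPochInf_eq_one_sub_mul (x : ℂ) {q : ℂ} (hq : ‖q‖ < 1) :
    qPochInf x q = (1 - x) * qPochInf (x * q) q := by
  simpa [qPoch] using qPochInf_eq_qPoch_mul x hq 1

theorem qPochInf_ne_zero {x q : ℂ} (hq : ‖q‖ < 1) (h : ∀ n : ℕ, x * q ^ n ≠ 1) :
    qPochInf x q ≠ 0 := by
  have hs : Summable (fun n : ℕ => ‖-(x * q ^ n)‖) := by
    simpa [norm_mul, norm_pow] using
      (summable_geometric_of_lt_one (norm_nonneg q) hq).mul_left ‖x‖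
  have := tprod_one_add_ne_zero_of_summable (f := fun n : ℕ => -(x * q ^ n))
    (fun i => by rw [← sub_eq_add_neg]; exact sub_ne_zero.2 (h i).symm) hs
  simpa [qPochInf, sub_eq_add_neg] using this

theorem qPochInf_ne_zero_of_norm_lt_one {z q : ℂ} (hq : ‖q‖ < 1) (hz : ‖z‖ < 1) :
    qPochInf z q ≠ 0 :=
  qPochInf_ne_zero hq (mul_pow_ne_one_of_norm_lt_one hz hq)

/-- The reciprocals converge because the limit `(x;q)_∞` is nonzero, and a convergent sequence is
bounded. -/
theorem exists_norm_inv_qPoch_le {x q : ℂ} (hq : ‖q‖ < 1) (h : ∀ n : ℕ, x * q ^ n ≠ 1) :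
    ∃ K : ℝ, 0 < K ∧ ∀ n, ‖(qPoch x q n)⁻¹‖ ≤ K := by
  have ht := ((tendsto_qPoch x hq).inv₀ (qPochInf_ne_zero hq h)).norm
  obtain ⟨K, hK⟩ := ht.bddAbove_range
  refine ⟨max K 1, by positivity, fun n => le_max_of_le_left (hK ⟨n, rfl⟩)⟩

/-! ### Gaussian coefficients and their decay. -/

/-- The coefficient `(-1)^n q^(n(n-1)/2)`. -/
def qTri (q : ℂ) (n : ℕ) : ℂ := (-1) ^ n * q ^ n.choose 2

theorem qTri_zero (q : ℂ) : qTri q 0 = 1 := by simp [qTri]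

theorem qTri_succ (q : ℂ) (n : ℕ) : qTri q (n + 1) = -q ^ n * qTri q n := by
  rw [qTri, qTri, Nat.choose_succ_succ' n 1, Nat.choose_one_right, pow_add, pow_succ]
  ring

theorem qTri_add (q : ℂ) (n m : ℕ) : qTri q (n + m) = qTri q n * qTri q m * q ^ (n * m) := by
  induction m with
  | zero => simp [qTri_zero]
  | succ m ih => rw [← add_assoc, qTri_succ, ih, qTri_succ]; ring

theorem qTri_mul_self (q : ℂ) (n : ℕ) : qTri q n * qTri q n * q ^ n = q ^ (n ^ 2) := by
  induction n with
  | zero => simp [qTri_zero]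
  | succ n ih =>
    rw [qTri_succ, show (n + 1) ^ 2 = n ^ 2 + (n + n + 1) by ring, pow_add q (n ^ 2), ← ih]
    ring

theorem norm_qTri (q : ℂ) (n : ℕ) : ‖qTri q n‖ = ‖q‖ ^ n.choose 2 := by simp [qTri]

theorem norm_qTri_le_one {q : ℂ} (hq : ‖q‖ < 1) (n : ℕ) : ‖qTri q n‖ ≤ 1 := by
  rw [norm_qTri]; exact pow_le_one₀ (norm_nonneg _) hq.le

/-- Consecutive terms have ratio `|q|^n |r| → 0`. The cases `r = 0` and `q = 0` are split off
because the ratio test needs nonzero terms. -/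
theorem summable_norm_qTri_mul_pow {q : ℂ} (hq : ‖q‖ < 1) (r : ℝ) :
    Summable fun n => ‖qTri q n‖ * r ^ n := by
  rcases eq_or_ne r 0 with rfl | hr
  · exact summable_of_ne_finset_zero (s := {0}) fun n hn => by
      simp at hn; simp [hn]
  rcases eq_or_ne q 0 with rfl | hq0
  · refine summable_of_ne_finset_zero (s := Finset.range 2) fun n hn => ?_
    have : 2 ≤ n := by simpa only [Finset.mem_range, not_lt] using hn
    have h2 : n.choose 2 ≠ 0 := (Nat.choose_pos this).ne'
    simp [norm_qTri, h2]
  refine summable_of_ratio_test_tendsto_lt_one (l := 0) one_pos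
    (Eventually.of_forall fun n => ?_) ?_
  · rw [norm_qTri]
    exact mul_ne_zero (pow_ne_zero _ (norm_ne_zero_iff.2 hq0)) (pow_ne_zero _ hr)
  · have ht := (tendsto_pow_atTop_nhds_zero_of_lt_one (norm_nonneg q) hq).mul_const |r|
    rw [zero_mul] at ht
    refine ht.congr fun n => ?_
    have h1 : ‖qTri q n‖ ≠ 0 := by
      rw [norm_qTri]; exact pow_ne_zero _ (norm_ne_zero_iff.2 hq0)
    rw [qTri_succ, norm_mul, norm_mul, norm_mul, norm_neg, norm_norm, norm_mul, norm_norm,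
      norm_pow, pow_succ, norm_mul, Real.norm_eq_abs r]
    have h2 : ‖r ^ n‖ ≠ 0 := by simp [hr]
    field_simp

/-! ### Analytic series and Euler's two expansions. -/

theorem differentiable_tsum_of_norm_le {F : ℕ → ℂ → ℂ} (hF : ∀ n, Differentiable ℂ (F n))
    (hb : ∀ R : ℝ, ∃ u : ℕ → ℝ, Summable u ∧ ∀ n z, ‖z‖ < R → ‖F n z‖ ≤ u n) :
    Differentiable ℂ fun z => ∑' n, F n z := by
  intro z
  obtain ⟨u, hu, hle⟩ := hb (‖z‖ + 1)
  have := Complex.differentiableOn_tsum_of_summable_norm hu (fun n => (hF n).differentiableOn)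
    (Metric.isOpen_ball (x := (0 : ℂ)) (ε := ‖z‖ + 1))
    (fun n w hw => hle n w (by simpa using hw))
  exact this.differentiableAt (Metric.isOpen_ball.mem_nhds (by simp))

theorem tendsto_mul_pow_nhds_zero (z : ℂ) {q : ℂ} (hq : ‖q‖ < 1) :
    Tendsto (fun n : ℕ => z * q ^ n) atTop (𝓝 0) := by
  simpa using (tendsto_pow_atTop_nhds_zero_of_norm_lt_one hq).const_mul z

/-- A function that is continuous at `0` and satisfies `f z = (1 - z) f (z q)` on a set stable
under multiplication by `q` is `f 0 (z;q)_∞`. -/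
theorem eq_mul_qPochInf_of_functional_eq {q : ℂ} (hq : ‖q‖ < 1) {f : ℂ → ℂ}
    (hf : ContinuousAt f 0) {z : ℂ}
    (h : ∀ n : ℕ, f (z * q ^ n) = (1 - z * q ^ n) * f (z * q ^ (n + 1))) :
    f z = qPochInf z q * f 0 := by
  have h1 : ∀ n : ℕ, f z = qPoch z q n * f (z * q ^ n) := by
    intro n
    induction n with
    | zero => simp [qPoch_zero]
    | succ n ih => rw [ih, h n, qPoch_succ, mul_assoc]
  exact tendsto_nhds_unique (tendsto_const_nhds.congr h1)
    ((tendsto_qPoch z hq).mul (hf.tendsto.comp (tendsto_mul_pow_nhds_zero z hq)))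

theorem summable_norm_pow_div_qPoch {q z : ℂ} (hq : ‖q‖ < 1) (hz : ‖z‖ < 1) :
    Summable fun n => ‖z ^ n / qPoch q q n‖ := by
  obtain ⟨K, -, hK⟩ := exists_norm_inv_qPoch_le hq (mul_pow_ne_one_of_norm_lt_one hq hq)
  refine .of_nonneg_of_le (fun _ => norm_nonneg _) (fun n => ?_)
    ((summable_geometric_of_lt_one (norm_nonneg z) hz).mul_right K)
  rw [div_eq_mul_inv, norm_mul, norm_pow]
  exact mul_le_mul_of_nonneg_left (hK n) (by positivity)

theorem summable_norm_qTri_mul_pow_div_qPoch {q : ℂ} (hq : ‖q‖ < 1) (z : ℂ) :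
    Summable fun n => ‖qTri q n * z ^ n / qPoch q q n‖ := by
  obtain ⟨K, -, hK⟩ := exists_norm_inv_qPoch_le hq (mul_pow_ne_one_of_norm_lt_one hq hq)
  refine .of_nonneg_of_le (fun _ => norm_nonneg _) (fun n => ?_)
    ((summable_norm_qTri_mul_pow hq ‖z‖).mul_right K)
  rw [div_eq_mul_inv, norm_mul, norm_mul, norm_pow]
  exact mul_le_mul_of_nonneg_left (hK n) (by positivity)

theorem one_div_qPoch_succ {q : ℂ} (hq : ‖q‖ < 1) (n : ℕ) :
    (1 - q ^ (n + 1)) / qPoch q q (n + 1) = 1 / qPoch q q n := by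
  have h1 := qPoch_self_ne_zero hq (n + 1)
  have h2 := qPoch_self_ne_zero hq n
  rw [div_eq_div_iff h1 h2, qPoch_succ]
  ring

/-- Euler's expansion of `1 / (z;q)_∞`. -/
theorem tsum_pow_div_qPoch {q z : ℂ} (hq : ‖q‖ < 1) (hz : ‖z‖ < 1) :
    ∑' n : ℕ, z ^ n / qPoch q q n = 1 / qPochInf z q := by
  set h : ℂ → ℂ := fun z => ∑' n : ℕ, z ^ n / qPoch q q n with hh
  have hs : ∀ {w : ℂ}, ‖w‖ < 1 → Summable fun n => w ^ n / qPoch q q n :=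
    fun hw => (summable_norm_pow_div_qPoch hq hw).of_norm
  have hqw : ∀ {w : ℂ}, ‖w‖ < 1 → ‖w * q‖ < 1 := fun {w} hw => by
    rw [norm_mul]; nlinarith [norm_nonneg w, norm_nonneg q]
  have hfun : ∀ w : ℂ, ‖w‖ < 1 → h (w * q) = (1 - w) * h w := by
    intro w hw
    have e1 : h w - h (w * q) = w * h w := by
      rw [hh]
      simp only
      rw [← (hs hw).tsum_sub (hs (hqw hw)), ((hs hw).sub (hs (hqw hw))).tsum_eq_zero_add,
        ← tsum_mul_left]
      simp only [pow_zero, sub_self, zero_add]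
      refine tsum_congr fun n => ?_
      have := one_div_qPoch_succ hq n
      calc w ^ (n + 1) / qPoch q q (n + 1) - (w * q) ^ (n + 1) / qPoch q q (n + 1)
          = w ^ (n + 1) * ((1 - q ^ (n + 1)) / qPoch q q (n + 1)) := by ring
        _ = _ := by rw [this]; ring
    linear_combination -e1
  have hcont : ContinuousAt h 0 := by
    obtain ⟨K, hK0, hK⟩ := exists_norm_inv_qPoch_le hq (mul_pow_ne_one_of_norm_lt_one hq hq)
    have := Complex.differentiableOn_tsum_of_summable_norm (F := fun n (w : ℂ) => w ^ n / qPoch q q n)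
      (u := fun n => (1 / 2 : ℝ) ^ n * K) (summable_geometric_two.mul_right K)
      (fun n => by fun_prop) (Metric.isOpen_ball (x := (0 : ℂ)) (ε := 1 / 2))
      (fun n w hw => by
        have hw' : ‖w‖ < 1 / 2 := by simpa using hw
        rw [div_eq_mul_inv, norm_mul, norm_pow]
        exact mul_le_mul (pow_le_pow_left₀ (norm_nonneg _) hw'.le n) (hK n) (norm_nonneg _)
          (by positivity))
    exact (this.differentiableAt
      (Metric.isOpen_ball.mem_nhds (by simp))).continuousAt
  have hzn : ∀ n : ℕ, ‖z * q ^ n‖ < 1 := by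
    intro n
    rw [norm_mul, norm_pow]
    exact (mul_le_of_le_one_right (norm_nonneg z)
      (pow_le_one₀ (norm_nonneg q) hq.le)).trans_lt hz
  have h0 : h 0 = 1 := by
    rw [hh]
    simp only
    rw [tsum_eq_single 0 (fun n hn => by simp [hn])]
    simp [qPoch_zero]
  -- Here the functional equation is `h(zq) = (1-z) h(z)`; iterating it drives the argument to `0`,
  -- where `h` is continuous with value `1`.
  have h1 : ∀ n : ℕ, qPoch z q n * h z = h (z * q ^ n) := by
    intro n
    induction n with
    | zero => simp [qPoch_zero]
    | succ n ih => rw [pow_succ, ← mul_assoc, hfun _ (hzn n), ← ih, qPoch_succ]; ring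
  have h2 : qPochInf z q * h z = 1 := by
    rw [← h0]
    exact tendsto_nhds_unique (((tendsto_qPoch z hq).mul_const _).congr h1)
      (hcont.tendsto.comp (tendsto_mul_pow_nhds_zero z hq))
  rw [eq_div_iff (qPochInf_ne_zero_of_norm_lt_one hq hz), mul_comm]
  exact h2

theorem differentiable_tsum_qTri {q : ℂ} (hq : ‖q‖ < 1) :
    Differentiable ℂ fun z => ∑' n : ℕ, qTri q n * z ^ n / qPoch q q n := by
  obtain ⟨K, hK0, hK⟩ := exists_norm_inv_qPoch_le hq (mul_pow_ne_one_of_norm_lt_one hq hq)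
  refine differentiable_tsum_of_norm_le (fun n => by fun_prop) fun R =>
    ⟨_, (summable_norm_qTri_mul_pow hq R).mul_right K, fun n z hz => ?_⟩
  rw [div_eq_mul_inv, norm_mul, norm_mul, norm_pow]
  have : ‖z‖ ^ n ≤ R ^ n := pow_le_pow_left₀ (norm_nonneg _) hz.le n
  have hR : 0 ≤ R := (norm_nonneg z).trans hz.le
  exact mul_le_mul (mul_le_mul_of_nonneg_left this (norm_nonneg _)) (hK n) (norm_nonneg _)
    (by positivity)

/-- Euler's expansion of `(z;q)_∞`. -/
theorem tsum_qTri_mul_pow_div_qPoch {q : ℂ} (hq : ‖q‖ < 1) (z : ℂ) :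
    ∑' n : ℕ, qTri q n * z ^ n / qPoch q q n = qPochInf z q := by
  set g : ℂ → ℂ := fun z => ∑' n : ℕ, qTri q n * z ^ n / qPoch q q n with hg
  have hs : ∀ w : ℂ, Summable fun n => qTri q n * w ^ n / qPoch q q n :=
    fun w => (summable_norm_qTri_mul_pow_div_qPoch hq w).of_norm
  have hfun : ∀ w : ℂ, g w = (1 - w) * g (w * q) := by
    intro w
    have e1 : g w - g (w * q) = -w * g (w * q) := by
      rw [hg]
      simp only
      rw [← (hs w).tsum_sub (hs _), ((hs w).sub (hs _)).tsum_eq_zero_add, ← tsum_mul_left]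
      simp only [pow_zero, sub_self, zero_add]
      refine tsum_congr fun n => ?_
      have := one_div_qPoch_succ hq n
      calc qTri q (n + 1) * w ^ (n + 1) / qPoch q q (n + 1)
            - qTri q (n + 1) * (w * q) ^ (n + 1) / qPoch q q (n + 1)
          = qTri q (n + 1) * w ^ (n + 1) * ((1 - q ^ (n + 1)) / qPoch q q (n + 1)) := by ring
        _ = _ := by rw [this, qTri_succ]; ring
    linear_combination e1
  have h0 : g 0 = 1 := by
    rw [hg]
    simp only
    rw [tsum_eq_single 0 (fun n hn => by simp [hn])]
    simp [qPoch_zero, qTri_zero]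
  have := eq_mul_qPochInf_of_functional_eq (z := z) hq (f := g)
    (differentiable_tsum_qTri hq 0).continuousAt
    (fun n => by rw [hfun (z * q ^ n), pow_succ, mul_assoc])
  rwa [h0, mul_one] at this

theorem differentiable_qPochInf {q : ℂ} (hq : ‖q‖ < 1) :
    Differentiable ℂ fun z => qPochInf z q := by
  simpa only [tsum_qTri_mul_pow_div_qPoch hq] using differentiable_tsum_qTri hq

/-! ### The finite and infinite `q`-binomial theorems. -/

/-- The finite `q`-binomial theorem. -/
theorem sum_antidiagonal_qTri {q : ℂ} (hq : ‖q‖ < 1) (z : ℂ) (N : ℕ) :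
    ∑ p ∈ Finset.HasAntidiagonal.antidiagonal N, qTri q p.1 * z ^ p.1 / (qPoch q q p.1 * qPoch q q p.2) =
      qPoch z q N / qPoch q q N := by
  induction N with
  | zero => simp [qTri_zero, qPoch_zero]
  | succ N ih =>
    set S := ∑ p ∈ Finset.HasAntidiagonal.antidiagonal N, qTri q p.1 * z ^ p.1 / (qPoch q q p.1 * qPoch q q p.2)
    have hN := qPoch_self_ne_zero hq (N + 1)
    have hN' := qPoch_self_ne_zero hq N
    have key : (1 - q ^ (N + 1)) * ∑ p ∈ Finset.HasAntidiagonal.antidiagonal (N + 1),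
        qTri q p.1 * z ^ p.1 / (qPoch q q p.1 * qPoch q q p.2) = S * (1 - z * q ^ N) := by
      -- A `q`-Pascal splitting: `1 - q^(i+j) = (1 - q^j) + q^j (1 - q^i)`. Each piece cancels the
      -- last factor of one denominator, lowering `N + 1` to `N`.
      have e1 : (1 - q ^ (N + 1)) * ∑ p ∈ Finset.HasAntidiagonal.antidiagonal (N + 1),
          qTri q p.1 * z ^ p.1 / (qPoch q q p.1 * qPoch q q p.2) =
          ∑ p ∈ Finset.HasAntidiagonal.antidiagonal (N + 1), qTri q p.1 * z ^ p.1 * (1 - q ^ p.2) /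
            (qPoch q q p.1 * qPoch q q p.2) +
          ∑ p ∈ Finset.HasAntidiagonal.antidiagonal (N + 1), qTri q p.1 * z ^ p.1 * q ^ p.2 * (1 - q ^ p.1) /
            (qPoch q q p.1 * qPoch q q p.2) := by
        rw [Finset.mul_sum, ← Finset.sum_add_distrib]
        refine Finset.sum_congr rfl fun p hp => ?_
        rw [← Finset.HasAntidiagonal.mem_antidiagonal.1 hp, pow_add]
        ring
      rw [e1, Finset.Nat.sum_antidiagonal_succ', Finset.Nat.sum_antidiagonal_succ]
      simp only [pow_zero, sub_self, mul_zero, zero_div, zero_add]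
      rw [mul_sub, mul_one, sub_eq_add_neg, Finset.sum_mul, ← Finset.sum_neg_distrib]
      congr 1
      · refine Finset.sum_congr rfl fun p _ => ?_
        have := one_div_qPoch_succ hq p.2
        calc qTri q p.1 * z ^ p.1 * (1 - q ^ (p.2 + 1)) / (qPoch q q p.1 * qPoch q q (p.2 + 1))
            = qTri q p.1 * z ^ p.1 / qPoch q q p.1 *
              ((1 - q ^ (p.2 + 1)) / qPoch q q (p.2 + 1)) := by ring
          _ = _ := by rw [this]; ring
      · refine Finset.sum_congr rfl fun p hp => ?_
        have := one_div_qPoch_succ hq p.1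
        calc qTri q (p.1 + 1) * z ^ (p.1 + 1) * q ^ p.2 * (1 - q ^ (p.1 + 1)) /
              (qPoch q q (p.1 + 1) * qPoch q q p.2)
            = qTri q (p.1 + 1) * z ^ (p.1 + 1) * q ^ p.2 / qPoch q q p.2 *
              ((1 - q ^ (p.1 + 1)) / qPoch q q (p.1 + 1)) := by ring
          _ = _ := by
              rw [this, qTri_succ, ← Finset.HasAntidiagonal.mem_antidiagonal.1 hp, pow_add]; ring
    rw [eq_div_iff hN, qPoch_succ, qPoch_succ z]
    rw [ih, div_mul_eq_mul_div, eq_div_iff hN'] at key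
    rw [← key, pow_succ']
    ring

/-- The `q`-binomial theorem. -/
theorem tsum_qPoch_mul_pow_div {q z : ℂ} (hq : ‖q‖ < 1) (hz : ‖z‖ < 1) (x : ℂ) :
    ∑' n : ℕ, qPoch x q n * z ^ n / qPoch q q n = qPochInf (x * z) q / qPochInf z q := by
  rw [← tsum_qTri_mul_pow_div_qPoch hq, div_eq_mul_one_div, ← tsum_pow_div_qPoch hq hz,
    tsum_mul_tsum_eq_tsum_sum_antidiagonal_of_summable_norm
      (summable_norm_qTri_mul_pow_div_qPoch hq _) (summable_norm_pow_div_qPoch hq hz)]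
  refine tsum_congr fun N => ?_
  rw [mul_div_right_comm, ← sum_antidiagonal_qTri hq, Finset.sum_mul]
  refine Finset.sum_congr rfl fun p hp => ?_
  rw [← Finset.HasAntidiagonal.mem_antidiagonal.1 hp, pow_add, mul_pow]
  ring

/-! ### The Jacobi triple product and a bilateral summation. -/

/-- The coefficient `(-1)^m q^(m(m-1)/2)` for an integer `m`. -/
noncomputable def qTriInt (q : ℂ) (m : ℤ) : ℂ := (-1) ^ m * q ^ (m * (m - 1) / 2)

theorem qTriInt_add_one {q : ℂ} (hq0 : q ≠ 0) (m : ℤ) :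
    qTriInt q (m + 1) = -q ^ m * qTriInt q m := by
  have h : (m + 1) * (m + 1 - 1) / 2 = m * (m - 1) / 2 + m := by
    rw [show (m + 1) * (m + 1 - 1) = m * (m - 1) + m * 2 by ring]
    exact Int.add_mul_ediv_right _ _ two_ne_zero
  rw [qTriInt, qTriInt, h, zpow_add₀ hq0, zpow_add_one₀ (by norm_num)]
  ring

theorem qTriInt_add_natCast {q : ℂ} (hq0 : q ≠ 0) (m : ℤ) (r : ℕ) :
    qTriInt q (m + r) = qTriInt q m * qTri q r * (q ^ m) ^ r := by
  induction r with
  | zero => simp [qTri_zero]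
  | succ r ih =>
    rw [Nat.cast_succ, ← add_assoc, qTriInt_add_one hq0, ih, qTri_succ, zpow_add₀ hq0,
      zpow_natCast]
    ring

theorem qTriInt_natCast {q : ℂ} (hq0 : q ≠ 0) (n : ℕ) : qTriInt q n = qTri q n := by
  have := qTriInt_add_natCast hq0 0 n
  simpa [qTriInt] using this

theorem qTriInt_sub_natCast {q : ℂ} (hq0 : q ≠ 0) (m : ℤ) (r : ℕ) :
    qTriInt q (m - r) = qTriInt q m * qTri q r * (q ^ (1 - m)) ^ r := by
  have h := qTriInt_add_natCast hq0 (m - r) r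
  have h2 := qTri_mul_self q r
  have h3 : q ^ r ^ 2 ≠ 0 := pow_ne_zero _ hq0
  rw [sub_add_cancel] at h
  have h4 : (q ^ (m - r)) ^ r * (q ^ (1 - m)) ^ r * q ^ (r ^ 2) = q ^ r := by
    rw [← mul_pow, ← zpow_add₀ hq0, sq, pow_mul, ← mul_pow, ← zpow_natCast q r, ← zpow_add₀ hq0]
    congr 1
    rw [show m - (r : ℤ) + (1 - m) + r = 1 by ring, zpow_one]
  rw [h]
  refine mul_right_cancel₀ h3 ?_
  calc qTriInt q (m - r) * q ^ r ^ 2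
      = qTriInt q (m - r) * (qTri q r * qTri q r * q ^ r) := by rw [h2]
    _ = _ := by rw [← h4]; ring

theorem qTriInt_neg {q : ℂ} (hq0 : q ≠ 0) (r : ℕ) : qTriInt q (-r) = qTri q r * q ^ r := by
  have := qTriInt_sub_natCast hq0 0 r
  simpa [qTriInt] using this

theorem summable_norm_qTriInt_mul_zpow {q : ℂ} (hq0 : q ≠ 0) (hq : ‖q‖ < 1) (w : ℂ) :
    Summable fun m : ℤ => ‖qTriInt q m * w ^ m‖ := by
  refine Summable.of_nat_of_neg ?_ ?_
  · refine (summable_norm_qTri_mul_pow hq ‖w‖).congr fun n => ?_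
    rw [qTriInt_natCast hq0, zpow_natCast, norm_mul, norm_pow]
  · refine (summable_norm_qTri_mul_pow hq ‖q / w‖).congr fun n => ?_
    rw [qTriInt_neg hq0, zpow_neg, zpow_natCast, ← norm_pow, ← norm_mul, div_pow]
    congr 1
    ring

/-- The equivalence of `ℤ × ℕ` that shifts the first coordinate by a function of the second. -/
def shiftEquiv (σ : ℕ → ℤ) : ℤ × ℕ ≃ ℤ × ℕ where
  toFun p := (p.1 + σ p.2, p.2)
  invFun p := (p.1 - σ p.2, p.2)
  left_inv p := by simp
  right_inv p := by simp

theorem summable_norm_shift_mul {f : ℤ → ℂ} {g : ℕ → ℂ} (hf : Summable fun m => ‖f m‖)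
    (hg : Summable fun n => ‖g n‖) (σ : ℕ → ℤ) :
    Summable fun p : ℤ × ℕ => ‖f (p.1 + σ p.2) * g p.2‖ :=
  (shiftEquiv σ).summable_iff.2 (summable_mul_of_summable_norm hf hg).norm

/-- The shear `(y, r) ↦ (y + σ r, r)` permutes `ℤ × ℕ`, so it does not change the absolutely
convergent product series. -/
theorem tsum_tsum_shift_mul {f : ℤ → ℂ} {g : ℕ → ℂ} (hf : Summable fun m => ‖f m‖)
    (hg : Summable fun n => ‖g n‖) (σ : ℕ → ℤ) :
    ∑' y : ℤ, ∑' r : ℕ, f (y + σ r) * g r = (∑' m, f m) * ∑' r, g r := by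
  rw [tsum_mul_tsum_of_summable_norm hf hg, ← (shiftEquiv σ).tsum_eq]
  exact (summable_norm_shift_mul hf hg σ).of_norm.tsum_prod.symm

theorem qPochInf_self_mul {q : ℂ} (hq : ‖q‖ < 1) (n : ℕ) :
    qPochInf (q * q ^ n) q = qPochInf q q / qPoch q q n := by
  rw [qPochInf_eq_qPoch_mul q hq n, mul_div_cancel_left₀ _ (qPoch_self_ne_zero hq n)]

theorem qPochInf_eq_zero {x q : ℂ} (hq : ‖q‖ < 1) (n : ℕ) (h : x * q ^ n = 1) :
    qPochInf x q = 0 := by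
  rw [qPochInf_eq_qPoch_mul x hq (n + 1), qPoch_succ, h]
  simp

/-- The series `∑ (-1)^m q^{m(m-1)/2} w^m (q^{m+1};q)_∞` over `ℤ` is computed twice. Its terms with
`m < 0` vanish, so Euler gives `(w, q;q)_∞`. Expanding `(q^{m+1};q)_∞` and shearing gives the theta
series divided by `(q/w;q)_∞`; this needs `|q/w| < 1`. -/
theorem jacobi_triple_product_of_norm_lt {q w : ℂ} (hq0 : q ≠ 0) (hq : ‖q‖ < 1)
    (hw : ‖q‖ < ‖w‖) :
    ∑' m : ℤ, qTriInt q m * w ^ m = qPochInf w q * qPochInf (q / w) q * qPochInf q q := by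
  have hw0 : w ≠ 0 := norm_pos_iff.1 ((norm_nonneg q).trans_lt hw)
  have hqw : ‖q / w‖ < 1 := by
    rw [norm_div]; exact (div_lt_one (norm_pos_iff.2 hw0)).2 hw
  have h1 : qPochInf w q * qPochInf q q =
      ∑' m : ℤ, qTriInt q m * w ^ m * qPochInf (q * q ^ m) q := by
    rw [← tsum_qTri_mul_pow_div_qPoch hq w, ← tsum_mul_right]
    rw [← (Nat.cast_injective (R := ℤ)).tsum_eq]
    · refine tsum_congr fun n => ?_
      rw [qTriInt_natCast hq0, zpow_natCast, zpow_natCast, qPochInf_self_mul hq]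
      ring
    · intro m hm
      by_contra hneg
      have hm0 : m < 0 := by
        by_contra h
        exact hneg ⟨m.toNat, Int.toNat_of_nonneg (not_lt.1 h)⟩
      refine hm ?_
      have : qPochInf (q * q ^ m) q = 0 := by
        refine qPochInf_eq_zero hq (-m - 1).toNat ?_
        rw [← zpow_natCast, Int.toNat_of_nonneg (by lia), mul_assoc, ← zpow_add₀ hq0,
          ← zpow_one_add₀ hq0, show 1 + (m + (-m - 1)) = 0 by ring, zpow_zero]
      simp [this]
  have h2 : ∀ m : ℤ, qTriInt q m * w ^ m * qPochInf (q * q ^ m) q =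
      ∑' r : ℕ, (qTriInt q (m + r) * w ^ (m + r)) * ((q / w) ^ r / qPoch q q r) := by
    intro m
    rw [← tsum_qTri_mul_pow_div_qPoch hq, ← tsum_mul_left]
    refine tsum_congr fun r => ?_
    rw [qTriInt_add_natCast hq0, zpow_add₀ hw0, zpow_natCast, div_pow]
    field_simp
    ring
  have h3 := tsum_tsum_shift_mul (summable_norm_qTriInt_mul_zpow hq0 hq w)
    (summable_norm_pow_div_qPoch hq hqw) (fun r => (r : ℤ))
  rw [tsum_pow_div_qPoch hq hqw, ← tsum_congr h2, ← h1] at h3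
  have h4 := qPochInf_ne_zero_of_norm_lt_one hq hqw
  field_simp at h3
  rw [← h3]
  ring

/-- The Jacobi triple product identity. -/
theorem jacobi_triple_product {q w : ℂ} (hq0 : q ≠ 0) (hq : ‖q‖ < 1) (hw : w ≠ 0) :
    ∑' m : ℤ, qTriInt q m * w ^ m = qPochInf w q * qPochInf (q / w) q * qPochInf q q := by
  -- Both sides are multiplied by `-1/w` under `w ↦ wq`, which extends the identity inwards from
  -- `|w| > |q|`, one annulus at a time.
  have step : ∀ {w : ℂ}, w ≠ 0 →
      ∑' m : ℤ, qTriInt q m * w ^ m = qPochInf w q * qPochInf (q / w) q * qPochInf q q →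
      ∑' m : ℤ, qTriInt q m * (w * q) ^ m =
        qPochInf (w * q) q * qPochInf (q / (w * q)) q * qPochInf q q := by
    intro w hw h
    have e1 : ∑' m : ℤ, qTriInt q m * (w * q) ^ m = -w⁻¹ * ∑' m : ℤ, qTriInt q m * w ^ m := by
      rw [← (Equiv.addRight (1 : ℤ)).tsum_eq (fun m : ℤ => qTriInt q m * w ^ m), ← tsum_mul_left]
      refine tsum_congr fun m => ?_
      rw [Equiv.coe_addRight, qTriInt_add_one hq0, mul_zpow, zpow_add_one₀ hw]
      field_simp
    have e2 : q / (w * q) * q = q / w := by field_simp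
    rw [e1, h, qPochInf_eq_one_sub_mul w hq, qPochInf_eq_one_sub_mul (q / (w * q)) hq, e2]
    field_simp
    ring
  have all : ∀ n : ℕ, ∀ w : ℂ, w ≠ 0 → ‖q‖ ^ (n + 1) < ‖w‖ →
      ∑' m : ℤ, qTriInt q m * w ^ m = qPochInf w q * qPochInf (q / w) q * qPochInf q q := by
    intro n
    induction n with
    | zero =>
      intro w _ hw
      exact jacobi_triple_product_of_norm_lt hq0 hq (by simpa using hw)
    | succ n ih =>
      intro w hw0 hw
      have := step (div_ne_zero hw0 hq0) (ih (w / q) (div_ne_zero hw0 hq0) (by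
        rw [norm_div, lt_div_iff₀ (norm_pos_iff.2 hq0), ← pow_succ]
        exact hw))
      rwa [div_mul_cancel₀ _ hq0] at this
  obtain ⟨n, hn⟩ := exists_pow_lt_of_lt_one (norm_pos_iff.2 hw) hq
  refine all n w hw (lt_of_le_of_lt ?_ hn)
  exact pow_le_pow_of_le_one (norm_nonneg q) hq.le (Nat.le_succ n)

theorem qTriInt_mul_qPochInf_eq_tsum {q w : ℂ} (hq0 : q ≠ 0) (hq : ‖q‖ < 1) (hw : w ≠ 0)
    (z : ℂ) (y : ℤ) :
    qTriInt q y * w ^ y * qPochInf (z / w * q ^ (1 - y)) q =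
      ∑' r : ℕ, (qTriInt q (y + -(r : ℤ)) * w ^ (y + -(r : ℤ))) * (z ^ r / qPoch q q r) := by
  rw [← tsum_qTri_mul_pow_div_qPoch hq, ← tsum_mul_left]
  refine tsum_congr fun r => ?_
  rw [← sub_eq_add_neg, qTriInt_sub_natCast hq0, zpow_sub₀ hw, zpow_natCast, mul_pow, div_pow]
  ring

/-- The bilateral sum `∑ (x;q)_y z^y` in terms of infinite products (Ramanujan's summation with
one vanishing parameter). -/
theorem tsum_qTriInt_mul_qPochInf {q w z : ℂ} (hq0 : q ≠ 0) (hq : ‖q‖ < 1) (hw : w ≠ 0)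
    (hz : ‖z‖ < 1) :
    ∑' y : ℤ, qTriInt q y * w ^ y * qPochInf (z / w * q ^ (1 - y)) q =
      qPochInf w q * qPochInf (q / w) q * qPochInf q q / qPochInf z q := by
  rw [tsum_congr (qTriInt_mul_qPochInf_eq_tsum hq0 hq hw z),
    tsum_tsum_shift_mul (summable_norm_qTriInt_mul_zpow hq0 hq w)
      (summable_norm_pow_div_qPoch hq hz) (fun r => -(r : ℤ)),
    jacobi_triple_product hq0 hq hw, tsum_pow_div_qPoch hq hz]
  ring

/-- The majorant must be uniform in `x`, since it is used for all `x = cq^n` at once. -/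
theorem exists_summable_norm_qTriInt_mul_qPochInf_le {q w z : ℂ} (hq0 : q ≠ 0) (hq : ‖q‖ < 1)
    (hw : w ≠ 0) (hz : ‖z‖ < 1) :
    ∃ G : ℤ → ℝ, Summable G ∧ ∀ (x : ℂ) (y : ℤ), ‖x‖ ≤ ‖z‖ →
      ‖qTriInt q y * w ^ y * qPochInf (x / w * q ^ (1 - y)) q‖ ≤ G y := by
  have hs := summable_norm_shift_mul (summable_norm_qTriInt_mul_zpow hq0 hq w)
      (summable_norm_pow_div_qPoch hq hz) (fun r => -(r : ℤ))
  refine ⟨_, hs.prod, fun x y hx => ?_⟩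
  rw [qTriInt_mul_qPochInf_eq_tsum hq0 hq hw x]
  refine tsum_of_norm_bounded (hs.prod_factor y).hasSum fun r => ?_
  simp only [norm_mul, norm_div, norm_pow]
  gcongr

/-! ### Transformations of the series `qPhi`. -/

theorem tsum_prod_eq_tsum_sum_antidiagonal {f : ℕ × ℕ → ℂ} (hf : Summable f) :
    ∑' p, f p = ∑' N : ℕ, ∑ p ∈ Finset.HasAntidiagonal.antidiagonal N, f p := by
  have h := (Finset.HasAntidiagonal.sigmaAntidiagonalEquivProd.summable_iff.2 hf).tsum_sigma'
    fun _ => .of_finite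
  refine (Finset.HasAntidiagonal.sigmaAntidiagonalEquivProd.tsum_eq f).symm.trans
    (h.trans (tsum_congr fun N => ?_))
  rw [tsum_fintype]
  exact Finset.sum_coe_sort _ f

/-- Expand `(uq^n;q)_∞` by Euler and interchange: the sum over `n` becomes `1/(zq^N;q)_∞`. -/
theorem qPochInf_mul_tsum_pow_mul_qPochInf {q z : ℂ} (hq : ‖q‖ < 1) (hz : ‖z‖ < 1) (u : ℂ) :
    qPochInf z q * ∑' n : ℕ, z ^ n * qPochInf (u * q ^ n) q / qPoch q q n =
      ∑' N : ℕ, qTri q N * u ^ N * qPoch z q N / qPoch q q N := by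
  have hs : Summable (Function.uncurry fun n N : ℕ =>
      z ^ n / qPoch q q n * (qTri q N * (u * q ^ n) ^ N / qPoch q q N)) := by
    refine Summable.of_norm_bounded (summable_mul_of_summable_norm
      (summable_norm_pow_div_qPoch hq hz) (summable_norm_qTri_mul_pow_div_qPoch hq u)).norm ?_
    rintro ⟨n, N⟩
    simp only [Function.uncurry, norm_mul, norm_div, norm_pow, mul_pow]
    gcongr
    exact mul_le_of_le_one_right (by positivity)
      (pow_le_one₀ (by positivity) (pow_le_one₀ (norm_nonneg q) hq.le))
  have hzn : ∀ N : ℕ, ‖z * q ^ N‖ < 1 := fun N => by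
    rw [norm_mul, norm_pow]
    exact (mul_le_of_le_one_right (norm_nonneg z)
      (pow_le_one₀ (norm_nonneg q) hq.le)).trans_lt hz
  have e1 : ∀ n : ℕ, z ^ n * qPochInf (u * q ^ n) q / qPoch q q n =
      ∑' N : ℕ, z ^ n / qPoch q q n * (qTri q N * (u * q ^ n) ^ N / qPoch q q N) := by
    intro n
    rw [tsum_mul_left, tsum_qTri_mul_pow_div_qPoch hq]
    ring
  rw [tsum_congr e1, ← hs.tsum_comm, ← tsum_mul_left]
  refine tsum_congr fun N => ?_
  have e2 : ∀ n : ℕ, z ^ n / qPoch q q n * (qTri q N * (u * q ^ n) ^ N / qPoch q q N) =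
      qTri q N * u ^ N / qPoch q q N * ((z * q ^ N) ^ n / qPoch q q n) := fun n => by
    rw [mul_pow, mul_pow, ← pow_mul, ← pow_mul, mul_comm n N]
    ring
  rw [tsum_congr e2, tsum_mul_left, tsum_pow_div_qPoch hq (hzn N), qPochInf_eq_qPoch_mul z hq N]
  have := qPochInf_ne_zero_of_norm_lt_one hq (hzn N)
  field_simp

/-- Expand `(uq^n;q)_∞` by Euler and collect along diagonals; `qTri_add` makes each diagonal a
finite `q`-binomial sum. -/
theorem tsum_qTri_sq_mul_qPochInf {q : ℂ} (hq : ‖q‖ < 1) (u z : ℂ) :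
    ∑' n : ℕ, qTri q n * qTri q n * (u * z) ^ n * qPochInf (u * q ^ n) q / qPoch q q n =
      ∑' N : ℕ, qTri q N * u ^ N * qPoch z q N / qPoch q q N := by
  have hs : Summable fun p : ℕ × ℕ => qTri q p.1 * (qTri q p.1 * (u * z) ^ p.1 / qPoch q q p.1) *
      (qTri q p.2 * (u * q ^ p.1) ^ p.2 / qPoch q q p.2) := by
    refine Summable.of_norm_bounded (summable_mul_of_summable_norm
      (summable_norm_qTri_mul_pow_div_qPoch hq (u * z))
      (summable_norm_qTri_mul_pow_div_qPoch hq u)).norm ?_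
    rintro ⟨n, N⟩
    simp only [norm_mul, norm_div, norm_pow, mul_pow]
    gcongr
    · exact mul_le_of_le_one_left (by positivity) (norm_qTri_le_one hq n)
    · exact mul_le_of_le_one_right (by positivity)
        (pow_le_one₀ (by positivity) (pow_le_one₀ (norm_nonneg q) hq.le))
  have e1 : ∀ n : ℕ, qTri q n * qTri q n * (u * z) ^ n * qPochInf (u * q ^ n) q / qPoch q q n =
      ∑' N : ℕ, qTri q n * (qTri q n * (u * z) ^ n / qPoch q q n) *
        (qTri q N * (u * q ^ n) ^ N / qPoch q q N) := by
    intro n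
    rw [tsum_mul_left, tsum_qTri_mul_pow_div_qPoch hq]
    ring
  rw [tsum_congr e1, ← hs.tsum_prod, tsum_prod_eq_tsum_sum_antidiagonal hs]
  refine tsum_congr fun N => ?_
  rw [mul_div_assoc, ← sum_antidiagonal_qTri hq, Finset.mul_sum]
  refine Finset.sum_congr rfl fun p hp => ?_
  rw [← Finset.HasAntidiagonal.mem_antidiagonal.1 hp, qTri_add, pow_add, mul_pow, mul_pow,
    ← pow_mul]
  ring

/-- The series `∑ a^n q^(n²+n) (a s q^n;q)_∞ / (q;q)_n`. -/
noncomputable def qPhi (a q s : ℂ) : ℂ :=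
  ∑' n : ℕ, a ^ n * q ^ (n ^ 2 + n) * qPochInf (a * q ^ n * s) q / qPoch q q n

theorem qPhi_eq_tsum {a q s z : ℂ} (hq : ‖q‖ < 1) (h : s * z = q ^ 2) :
    qPhi a q s = ∑' N : ℕ, qTri q N * (a * s) ^ N * qPoch z q N / qPoch q q N := by
  rw [← tsum_qTri_sq_mul_qPochInf hq, qPhi]
  refine tsum_congr fun n => ?_
  rw [show a * s * z = a * q ^ 2 by rw [← h]; ring, pow_add, ← qTri_mul_self, mul_pow, ← pow_mul]
  ring_nf

theorem qPhi_eq_qPochInf_mul_tsum {a q s z : ℂ} (hq : ‖q‖ < 1) (hz : ‖z‖ < 1)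
    (h : s * z = q ^ 2) :
    qPhi a q s =
      qPochInf z q * ∑' n : ℕ, z ^ n * qPochInf (a * q ^ n * s) q / qPoch q q n := by
  rw [qPhi_eq_tsum hq h, ← qPochInf_mul_tsum_pow_mul_qPochInf hq hz]
  simp only [mul_right_comm a s]

/-- The case `z = 1` of the preceding transformation: `(1;q)_N` vanishes for `N > 0`. This is
Cauchy's identity with `(uq;q)_∞` multiplied through. -/
theorem tsum_pow_sq_mul_qPochInf {q : ℂ} (hq : ‖q‖ < 1) (u : ℂ) :
    ∑' n : ℕ, u ^ n * q ^ (n ^ 2) * qPochInf (u * q * q ^ n) q / qPoch q q n = 1 := by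
  have h := tsum_qTri_sq_mul_qPochInf hq (u * q) 1
  rw [tsum_eq_single (f := fun N : ℕ => qTri q N * (u * q) ^ N * qPoch 1 q N / qPoch q q N) 0] at h
  · simp only [qTri_zero, qPoch_zero, pow_zero, mul_one, div_one] at h
    rw [← h]
    refine tsum_congr fun n => ?_
    rw [← qTri_mul_self, mul_pow]
    ring
  · intro n hn
    obtain ⟨m, rfl⟩ := Nat.exists_eq_succ_of_ne_zero hn
    simp [qPoch_succ']

theorem ne_one_shift {x q : ℂ} (h : ∀ n : ℕ, x * q ^ n ≠ 1) (m : ℕ) :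
    ∀ n : ℕ, x * q ^ m * q ^ n ≠ 1 := fun n => by
  rw [mul_assoc, ← pow_add]; exact h _

/-! ### A limiting Rogers–Fine identity. -/

section RogersFine

variable {q β : ℂ}

theorem summable_norm_qTri_mul_pow_div (hq : ‖q‖ < 1) (hβ : ∀ n : ℕ, β * q ^ n ≠ 1) (x : ℂ) :
    Summable fun k : ℕ => ‖qTri q k * x ^ k / qPoch β q k‖ := by
  obtain ⟨K, -, hK⟩ := exists_norm_inv_qPoch_le hq hβ
  refine .of_nonneg_of_le (fun _ => norm_nonneg _) (fun n => ?_)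
    ((summable_norm_qTri_mul_pow hq ‖x‖).mul_right K)
  rw [div_eq_mul_inv, norm_mul, norm_mul, norm_pow]
  exact mul_le_mul_of_nonneg_left (hK n) (by positivity)

theorem tsum_qTri_mul_pow_div_recurrence (hq : ‖q‖ < 1) (hβ : ∀ n : ℕ, β * q ^ n ≠ 1) (x : ℂ) :
    ∑' k : ℕ, qTri q k * x ^ k / qPoch β q k = 1 - x - x * (β - x * q) / (1 - β) *
      ∑' k : ℕ, qTri q k * (x * q ^ 2) ^ k / qPoch (β * q) q k := by
  have hβ1 : 1 - β ≠ 0 := by simpa using sub_ne_zero.2 (hβ 0).symm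
  have hne := qPoch_ne_zero hβ
  have hs := (summable_norm_qTri_mul_pow_div hq hβ x).of_norm
  have hs' := (summable_norm_qTri_mul_pow_div hq
    (by simpa using ne_one_shift hβ 1) (x * q ^ 2)).of_norm
  have hP : ∀ k : ℕ, qPoch (β * q) q k = qPoch β q (k + 1) / (1 - β) := fun k => by
    rw [qPoch_succ', mul_div_cancel_left₀ _ hβ1]
  set g : ℕ → ℂ := fun k => qTri q k * x ^ k / qPoch β q k with hg
  set g₂ : ℕ → ℂ := fun k => qTri q (k + 2) * x ^ (k + 2) / qPoch β q (k + 1)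
  set g₁ : ℕ → ℂ := fun k => β * q ^ k * (qTri q (k + 1) * x ^ (k + 1)) / qPoch β q (k + 1)
  have e1 : ∀ k, x * (β - x * q) / (1 - β) *
      (qTri q k * (x * q ^ 2) ^ k / qPoch (β * q) q k) = - g₁ k - g₂ k := by
    intro k
    have := hne (k + 1)
    simp only [g₁, g₂]
    rw [hP, qTri_succ q (k + 1), qTri_succ, mul_pow, ← pow_mul]
    field_simp
    ring
  have s1 : Summable g₁ := by
    refine (((summable_nat_add_iff 1).2
      (summable_norm_qTri_mul_pow_div hq hβ x)).mul_left ‖β‖).of_norm_bounded fun k => ?_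
    have : g₁ k = β * (q ^ k * (qTri q (k + 1) * x ^ (k + 1) / qPoch β q (k + 1))) := by
      simp only [g₁]; ring
    rw [this, norm_mul, norm_mul]
    refine mul_le_mul_of_nonneg_left ?_ (norm_nonneg _)
    rw [norm_pow]
    exact mul_le_of_le_one_left (norm_nonneg _) (pow_le_one₀ (norm_nonneg q) hq.le)
  have s2 : Summable g₂ := by
    have := ((hs'.mul_left (x * (β - x * q) / (1 - β))).congr fun k => by rw [e1 k]).add s1
    refine (this.neg).congr fun k => ?_
    ring
  -- This is `1/(1-t) = 1 + t/(1-t)` with `t = βq^(k+1)`. Together with `e1`, all but the initial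
  -- terms cancel.
  have e2 : ∀ k, g (k + 2) = g₁ (k + 1) + g₂ k := by
    intro k
    have h1 := hne (k + 1)
    have h2 := hne (k + 2)
    have h3 : qPoch β q (k + 2) = qPoch β q (k + 1) * (1 - β * q ^ (k + 1)) := qPoch_succ _ _ _
    have h4 : 1 - β * q ^ (k + 1) ≠ 0 := sub_ne_zero.2 (hβ _).symm
    simp only [hg, g₁, g₂]
    rw [show k + 1 + 1 = k + 2 by ring, h3]
    field_simp
    ring
  rw [← tsum_mul_left, tsum_congr e1, (s1.neg).tsum_sub s2, tsum_neg, hs.tsum_eq_zero_add,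
    ((summable_nat_add_iff 1).2 hs).tsum_eq_zero_add, tsum_congr e2,
    ((summable_nat_add_iff 1).2 s1).tsum_add s2, s1.tsum_eq_zero_add]
  simp only [hg, g₁, qTri_zero, qPoch_zero, pow_zero, zero_add, qTri_succ, qPoch_succ, pow_one]
  field_simp
  ring

/-- The coefficients of the limiting case of the Rogers–Fine identity. -/
noncomputable def rogersFineCoeff (β q x : ℂ) (k : ℕ) : ℂ :=
  qPoch (x * q / β) q k * (x * β) ^ k * qTri q k ^ 3 / qPoch β q k

/-- The recurrence sends `(β, x)` to `(βq, xq²)`; its `K`-fold iteration produces the coefficients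
and an explicit remainder. -/
theorem tsum_eq_sum_rogersFineCoeff_add (hq : ‖q‖ < 1) (hβ0 : β ≠ 0)
    (hβ : ∀ n : ℕ, β * q ^ n ≠ 1) (x : ℂ) (K : ℕ) :
    ∑' k : ℕ, qTri q k * x ^ k / qPoch β q k =
      ∑ k ∈ Finset.range K, rogersFineCoeff β q x k * (1 - x * q ^ (2 * k)) +
      rogersFineCoeff β q x K *
        ∑' k : ℕ, qTri q k * (x * q ^ (2 * K)) ^ k / qPoch (β * q ^ K) q k := by
  induction K with
  | zero => simp [rogersFineCoeff, qPoch_zero, qTri_zero]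
  | succ K ih =>
    have h1 := qPoch_ne_zero hβ K
    have h4 : 1 - β * q ^ K ≠ 0 := sub_ne_zero.2 (hβ _).symm
    have h2 : rogersFineCoeff β q x (K + 1) = -(rogersFineCoeff β q x K *
        (x * q ^ (2 * K) * (β * q ^ K - x * q ^ (2 * K) * q) / (1 - β * q ^ K))) := by
      simp only [rogersFineCoeff, qPoch_succ, qTri_succ]
      field_simp
      ring
    rw [ih, Finset.sum_range_succ, tsum_qTri_mul_pow_div_recurrence hq (ne_one_shift hβ K), h2]
    rw [show x * q ^ (2 * (K + 1)) = x * q ^ (2 * K) * q ^ 2 by ring,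
      show β * q ^ (K + 1) = β * q ^ K * q by ring]
    ring

theorem summable_norm_rogersFineCoeff (hq : ‖q‖ < 1) (hβ : ∀ n : ℕ, β * q ^ n ≠ 1) (x : ℂ) :
    Summable fun k => ‖rogersFineCoeff β q x k‖ := by
  obtain ⟨K, -, hK⟩ := exists_norm_inv_qPoch_le hq hβ
  refine .of_nonneg_of_le (fun _ => norm_nonneg _) (fun n => ?_)
    (((summable_norm_qTri_mul_pow hq ‖x * β‖).mul_left
      (Real.exp (‖x * q / β‖ / (1 - ‖q‖)))).mul_right K)
  rw [rogersFineCoeff, div_eq_mul_inv, norm_mul, norm_mul, norm_mul, norm_pow, norm_pow, mul_assoc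
    ‖qPoch _ q n‖, mul_comm (‖x * β‖ ^ n)]
  have h1 : ‖qTri q n‖ ^ 3 ≤ ‖qTri q n‖ :=
    pow_le_of_le_one (norm_nonneg _) (norm_qTri_le_one hq n) (by norm_num)
  gcongr
  · exact norm_qPoch_le _ hq n
  · exact hK n

/-- A limiting case of the Rogers–Fine identity. -/
theorem hasSum_rogersFine (hq : ‖q‖ < 1) (hβ0 : β ≠ 0) (hβ : ∀ n : ℕ, β * q ^ n ≠ 1) (x : ℂ) :
    HasSum (fun k : ℕ => rogersFineCoeff β q x k * (1 - x * q ^ (2 * k)))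
      (∑' k : ℕ, qTri q k * x ^ k / qPoch β q k) := by
  have hs := summable_norm_rogersFineCoeff hq hβ x
  have hsum : Summable fun k : ℕ => rogersFineCoeff β q x k * (1 - x * q ^ (2 * k)) := by
    refine (hs.mul_right (1 + ‖x‖)).of_norm_bounded fun k => ?_
    rw [norm_mul]
    refine mul_le_mul_of_nonneg_left ((norm_sub_le _ _).trans ?_) (norm_nonneg _)
    rw [norm_one, norm_mul, norm_pow]
    gcongr
    exact mul_le_of_le_one_right (norm_nonneg x) (pow_le_one₀ (norm_nonneg q) hq.le)
  obtain ⟨K, hK0, hK⟩ := exists_norm_inv_qPoch_le hq hβ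
  set M := Real.exp (‖β‖ / (1 - ‖q‖))
  have hbd : ∀ N : ℕ, ‖∑' k : ℕ, qTri q k * (x * q ^ (2 * N)) ^ k / qPoch (β * q ^ N) q k‖ ≤
      (∑' k : ℕ, ‖qTri q k‖ * ‖x‖ ^ k) * (M * K) := by
    intro N
    refine tsum_of_norm_bounded ((summable_norm_qTri_mul_pow hq ‖x‖).hasSum.mul_right _)
      fun k => ?_
    -- Writing the reciprocal as `(β;q)_N / (β;q)_{N+k}` bounds it uniformly in both `N` and `k`.
    have h1 : 1 / qPoch (β * q ^ N) q k = qPoch β q N * (qPoch β q (N + k))⁻¹ := by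
      have h2 := qPoch_ne_zero hβ N
      have h3 := qPoch_ne_zero (ne_one_shift hβ N) k
      rw [qPoch_add]
      field_simp
    rw [div_eq_mul_one_div, h1, norm_mul, norm_mul, norm_mul, norm_pow, norm_mul, norm_pow]
    gcongr
    · exact mul_le_of_le_one_right (norm_nonneg x) (pow_le_one₀ (norm_nonneg q) hq.le)
    · exact norm_qPoch_le _ hq N
    · exact hK _
  have hlim : Tendsto (fun N : ℕ => rogersFineCoeff β q x N *
      ∑' k : ℕ, qTri q k * (x * q ^ (2 * N)) ^ k / qPoch (β * q ^ N) q k) atTop (𝓝 0) := by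
    have h0 := hs.tendsto_atTop_zero.mul_const ((∑' k : ℕ, ‖qTri q k‖ * ‖x‖ ^ k) * (M * K))
    rw [zero_mul] at h0
    refine squeeze_zero_norm (fun N => ?_) h0
    rw [norm_mul]
    exact mul_le_mul_of_nonneg_left (hbd N) (norm_nonneg _)
  have h2 := hsum.hasSum.tendsto_sum_nat.add hlim
  rw [add_zero] at h2
  have h3 := tendsto_nhds_unique
    (tendsto_const_nhds.congr (tsum_eq_sum_rogersFineCoeff_add hq hβ0 hβ x)) h2
  rw [h3]
  exact hsum.hasSum

end RogersFine

/-! ### The double series and its power series in `b`. -/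

/-- One factor `z` goes into each factor of `(x;q)_k`. Only `z` and `xz` then enter, which matters
because `x` will grow like `q^{-n}`. -/
theorem norm_qPoch_mul_pow_le_prod (x z q : ℂ) (k : ℕ) :
    ‖qPoch x q k * z ^ k‖ ≤ ∏ i ∈ Finset.range k, (‖z‖ + ‖x * z‖ * ‖q‖ ^ i) := by
  have h : qPoch x q k * z ^ k = ∏ i ∈ Finset.range k, (z - x * z * q ^ i) := by
    induction k with
    | zero => simp [qPoch_zero]
    | succ k ih => rw [Finset.prod_range_succ, ← ih, qPoch_succ]; ring
  rw [h, norm_prod]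
  refine Finset.prod_le_prod (fun _ _ => norm_nonneg _) fun i _ => (norm_sub_le _ _).trans ?_
  rw [norm_mul (x * z), norm_pow]

theorem norm_qPoch_mul_pow_le (x z : ℂ) {q : ℂ} (hq : ‖q‖ < 1) (k : ℕ) :
    ‖qPoch x q k * z ^ k‖ ≤ (‖z‖ + ‖x * z‖) ^ k := by
  refine (norm_qPoch_mul_pow_le_prod x z q k).trans ?_
  refine (Finset.prod_le_prod (fun _ _ => by positivity) fun i _ => ?_).trans_eq
    (by rw [Finset.prod_const, Finset.card_range])
  gcongr
  exact mul_le_of_le_one_right (norm_nonneg _) (pow_le_one₀ (norm_nonneg q) hq.le)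

/-- Factoring out `r` keeps the geometric rate `r^k`, whereas the cruder bound has rate `‖z‖ +
‖xz‖`, which may exceed `1`. -/
theorem norm_qPoch_mul_pow_le_exp {x z q : ℂ} (hq : ‖q‖ < 1) {r s : ℝ} (hr : 0 < r)
    (hz : ‖z‖ ≤ r) (hxz : ‖x * z‖ ≤ s) (k : ℕ) :
    ‖qPoch x q k * z ^ k‖ ≤ r ^ k * Real.exp (s / r / (1 - ‖q‖)) := by
  have hs : 0 ≤ s := (norm_nonneg _).trans hxz
  have hgeo := summable_geometric_of_lt_one (norm_nonneg q) hq
  calc ‖qPoch x q k * z ^ k‖ ≤ ∏ i ∈ Finset.range k, (‖z‖ + ‖x * z‖ * ‖q‖ ^ i) :=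
        norm_qPoch_mul_pow_le_prod x z q k
    _ ≤ ∏ i ∈ Finset.range k, (r * Real.exp (s / r * ‖q‖ ^ i)) := by
        refine Finset.prod_le_prod (fun _ _ => by positivity) fun i _ => ?_
        calc ‖z‖ + ‖x * z‖ * ‖q‖ ^ i ≤ r + s * ‖q‖ ^ i := by gcongr
          _ = r * (s / r * ‖q‖ ^ i + 1) := by field_simp; ring
          _ ≤ _ := by gcongr; exact Real.add_one_le_exp _
    _ = r ^ k * Real.exp (s / r * ∑ i ∈ Finset.range k, ‖q‖ ^ i) := by
        rw [Finset.prod_mul_distrib, Finset.prod_const, Finset.card_range, ← Real.exp_sum,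
          Finset.mul_sum]
    _ ≤ r ^ k * Real.exp (s / r / (1 - ‖q‖)) := by
        rw [div_eq_mul_inv (s / r), ← tsum_geometric_of_lt_one (norm_nonneg q) hq]
        gcongr
        exact hgeo.sum_le_tsum _ fun i _ => by positivity

theorem norm_pow_sq_add_le {q : ℂ} (hq : ‖q‖ < 1) (n : ℕ) : ‖q ^ (n ^ 2 + n)‖ ≤ ‖qTri q n‖ := by
  rw [pow_add, ← qTri_mul_self, norm_mul, norm_mul, norm_mul, norm_pow]
  have h1 := norm_qTri_le_one hq n
  have h2 : ‖q‖ ^ n ≤ 1 := pow_le_one₀ (norm_nonneg q) hq.le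
  calc ‖qTri q n‖ * ‖qTri q n‖ * ‖q‖ ^ n * ‖q‖ ^ n ≤ ‖qTri q n‖ * 1 * 1 * 1 := by gcongr
    _ = _ := by ring

theorem summable_norm_pow_mul_pow_sq_div_qPoch {q : ℂ} (hq : ‖q‖ < 1) (a : ℂ) :
    Summable fun n : ℕ => ‖a ^ n * q ^ (n ^ 2 + n) / qPoch q q n‖ := by
  refine .of_nonneg_of_le (fun _ => norm_nonneg _) (fun n => ?_)
    (summable_norm_qTri_mul_pow_div_qPoch hq a)
  rw [mul_comm, norm_div, norm_div, norm_mul, norm_mul]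
  have := norm_pow_sq_add_le hq n
  gcongr

theorem norm_qPochInf_le_of_norm_le {q x a : ℂ} (hq : ‖q‖ < 1) (h : ‖x‖ ≤ ‖a‖) :
    ‖qPochInf x q‖ ≤ Real.exp (‖a‖ / (1 - ‖q‖)) := by
  refine (norm_qPochInf_le x hq).trans ?_
  have : 0 < 1 - ‖q‖ := sub_pos.2 hq
  gcongr

theorem norm_mul_pow_le {q : ℂ} (hq : ‖q‖ < 1) (x : ℂ) (n : ℕ) : ‖x * q ^ n‖ ≤ ‖x‖ := by
  rw [norm_mul, norm_pow]
  exact mul_le_of_le_one_right (norm_nonneg _) (pow_le_one₀ (norm_nonneg q) hq.le)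

theorem qTri_pow_three (q : ℂ) (k : ℕ) :
    qTri q k ^ 3 * q ^ (3 * k) = (-1) ^ k * q ^ (3 * k * (k + 1) / 2) := by
  have h : 3 * k * (k + 1) = 2 * (k.choose 2 * 3 + 3 * k) := by
    have : k * (k + 1) = 2 * (k.choose 2 + k) := by
      induction k with
      | zero => rfl
      | succ k ih =>
        rw [Nat.choose_succ_succ' k 1, Nat.choose_one_right]
        linarith
    linarith
  rw [h, Nat.mul_div_cancel_left _ two_pos, qTri, mul_pow, ← pow_mul, ← pow_mul, pow_add]
  have : ((-1 : ℂ)) ^ (k * 3) = (-1) ^ k := by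
    rw [mul_comm, pow_mul]; norm_num
  rw [this]
  ring

/-- The terms of the double series. -/
noncomputable def doubleTerm (a b q : ℂ) (n k : ℕ) : ℂ :=
  (-1) ^ k * qPoch (b * q ^ (-(n : ℤ)) / a) q k * a ^ (n + k) * b ^ (k + 1) *
      q ^ (n ^ 2 + n + n * k + 3 * k * (k + 1) / 2) * (1 - b * q ^ (2 * k + 1)) /
    (qPoch q q n * qPoch (a * q) q (n + k + 1))

theorem doubleTerm_eq (a b q : ℂ) (n k : ℕ) :
    doubleTerm a b q n k = a ^ n * q ^ (n ^ 2 + n) / qPoch q q n * b *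
      (qPoch (b * q ^ (-(n : ℤ)) / a) q k * (a * b * q ^ (n + 3)) ^ k * qTri q k ^ 3 *
        (1 - b * q * q ^ (2 * k))) * (qPoch (a * q) q (n + k + 1))⁻¹ := by
  have h : q ^ (n ^ 2 + n + n * k + 3 * k * (k + 1) / 2) * (-1) ^ k =
      q ^ (n ^ 2 + n) * q ^ (n * k) * (qTri q k ^ 3 * q ^ (3 * k)) := by
    rw [qTri_pow_three, pow_add, pow_add]; ring
  rw [doubleTerm, div_eq_mul_inv, mul_inv]
  calc _ = (q ^ (n ^ 2 + n + n * k + 3 * k * (k + 1) / 2) * (-1) ^ k) *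
        (qPoch (b * q ^ (-(n : ℤ)) / a) q k * a ^ (n + k) * b ^ (k + 1) *
        (1 - b * q ^ (2 * k + 1)) * ((qPoch q q n)⁻¹ * (qPoch (a * q) q (n + k + 1))⁻¹)) := by ring
    _ = _ := by rw [h]; ring

theorem doubleTerm_eq_rogersFineCoeff {a b q : ℂ} (hq0 : q ≠ 0) (ha : a ≠ 0) (n k : ℕ) :
    doubleTerm a b q n k =
      a ^ n * q ^ (n ^ 2 + n) / qPoch q q n * b * (qPoch (a * q) q (n + 1))⁻¹ *
        (rogersFineCoeff (a * q * q ^ (n + 1)) q (b * q) k * (1 - b * q * q ^ (2 * k))) := by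
  have h1 : b * q * q / (a * q * q ^ (n + 1)) = b * q ^ (-(n : ℤ)) / a := by
    rw [zpow_neg, zpow_natCast]; field_simp; ring
  have h2 : b * q * (a * q * q ^ (n + 1)) = a * b * q ^ (n + 3) := by ring
  rw [doubleTerm_eq, rogersFineCoeff, h1, h2, show n + k + 1 = n + 1 + k by ring, qPoch_add,
    mul_inv]
  ring

theorem summable_norm_doubleTerm {a b q : ℂ} (hq0 : q ≠ 0) (hq : ‖q‖ < 1) (ha : a ≠ 0)
    (haq : ∀ n : ℕ, a * q * q ^ n ≠ 1) :
    Summable fun p : ℕ × ℕ => ‖doubleTerm a b q p.1 p.2‖ := by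
  obtain ⟨K, hK0, hK⟩ := exists_norm_inv_qPoch_le hq haq
  refine .of_nonneg_of_le (fun _ => norm_nonneg _) ?_
    ((((summable_norm_pow_mul_pow_sq_div_qPoch hq a).mul_of_nonneg
      (summable_norm_qTri_mul_pow hq (‖a * b‖ + ‖b‖ * ‖b‖)) (fun _ => norm_nonneg _)
      (fun _ => by positivity)).mul_left (‖b‖ * (1 + ‖b‖))).mul_right K)
  rintro ⟨n, k⟩
  -- The growth of `q^{-n}` cancels against `q^{n+3}`, so the estimate is uniform in `n`.
  have hX : b * q ^ (-(n : ℤ)) / a * (a * b * q ^ (n + 3)) = b * b * q ^ 3 := by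
    rw [zpow_neg, zpow_natCast]; field_simp; ring
  have h1 : ‖qPoch (b * q ^ (-(n : ℤ)) / a) q k * (a * b * q ^ (n + 3)) ^ k‖ ≤
      (‖a * b‖ + ‖b‖ * ‖b‖) ^ k := by
    refine (norm_qPoch_mul_pow_le _ _ hq k).trans ?_
    rw [hX, ← norm_mul b b]
    gcongr
    · exact norm_mul_pow_le hq _ _
    · exact norm_mul_pow_le hq _ _
  have h2 : ‖qTri q k ^ 3‖ ≤ ‖qTri q k‖ := by
    rw [norm_pow]
    exact pow_le_of_le_one (norm_nonneg _) (norm_qTri_le_one hq k) (by norm_num)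
  have h3 : ‖1 - b * q * q ^ (2 * k)‖ ≤ 1 + ‖b‖ := by
    refine (norm_sub_le _ _).trans ?_
    rw [norm_one, mul_assoc, ← pow_succ']
    gcongr
    exact norm_mul_pow_le hq _ _
  rw [doubleTerm_eq, norm_mul, norm_mul, norm_mul, norm_mul _ (1 - b * q * q ^ (2 * k)),
    norm_mul _ (qTri q k ^ 3)]
  calc _ ≤ ‖a ^ n * q ^ (n ^ 2 + n) / qPoch q q n‖ * ‖b‖ *
        ((‖a * b‖ + ‖b‖ * ‖b‖) ^ k * ‖qTri q k‖ * (1 + ‖b‖)) * K := by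
          gcongr
          exact hK _
    _ = _ := by ring

/-- The power series in `b` to which the double series sums up. -/
noncomputable def residualSeries (a q b : ℂ) : ℂ :=
  ∑' k : ℕ, qTri q k * q ^ k * b ^ (k + 1) * qPhi a q (q ^ (k + 2))

/-- For fixed `n` the sum over `k` is the Rogers–Fine side with `β = aq^{n+2}`, `x = bq`. On the
other side `(aq;q)_∞` absorbs the denominators into `(aq^{n+k+2};q)_∞`, and summing over `n` first
yields `qPhi` at `q^{k+2}`. -/
theorem qPochInf_mul_tsum_doubleTerm {a b q : ℂ} (hq0 : q ≠ 0) (hq : ‖q‖ < 1) (ha : a ≠ 0)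
    (haq : ∀ n : ℕ, a * q * q ^ n ≠ 1) :
    qPochInf (a * q) q * ∑' n : ℕ, ∑' k : ℕ, doubleTerm a b q n k = residualSeries a q b := by
  have e1 : ∀ n : ℕ, qPochInf (a * q) q * ∑' k : ℕ, doubleTerm a b q n k =
      ∑' k : ℕ, a ^ n * q ^ (n ^ 2 + n) / qPoch q q n *
        (qTri q k * q ^ k * b ^ (k + 1)) * qPochInf (a * q ^ n * q ^ (k + 2)) q := by
    intro n
    have hβ := ne_one_shift haq (n + 1)
    have hβ0 : a * q * q ^ (n + 1) ≠ 0 := mul_ne_zero (mul_ne_zero ha hq0) (pow_ne_zero _ hq0)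
    have e2 := (hasSum_rogersFine hq hβ0 hβ (b * q)).tsum_eq
    rw [tsum_congr (doubleTerm_eq_rogersFineCoeff hq0 ha n), tsum_mul_left, e2, ← tsum_mul_left,
      ← tsum_mul_left]
    refine tsum_congr fun k => ?_
    have h1 := qPoch_ne_zero haq (n + 1)
    have h2 := qPoch_ne_zero hβ k
    have h3 := qPoch_self_ne_zero hq n
    rw [qPochInf_eq_qPoch_mul (a * q) hq (n + 1 + k), qPoch_add,
      show a * q * q ^ (n + 1 + k) = a * q ^ n * q ^ (k + 2) by ring]
    field_simp
    ring
  have hs : Summable (Function.uncurry fun n k : ℕ => a ^ n * q ^ (n ^ 2 + n) / qPoch q q n *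
        (qTri q k * q ^ k * b ^ (k + 1)) * qPochInf (a * q ^ n * q ^ (k + 2)) q) := by
    refine Summable.of_norm_bounded
      (((summable_norm_pow_mul_pow_sq_div_qPoch hq a).mul_of_nonneg
      ((summable_norm_qTri_mul_pow hq ‖b‖).mul_right ‖b‖) (fun _ => norm_nonneg _)
      (fun _ => by positivity)).mul_right (Real.exp (‖a‖ / (1 - ‖q‖)))) ?_
    rintro ⟨n, k⟩
    simp only [Function.uncurry]
    rw [norm_mul, norm_mul]
    gcongr
    · rw [norm_mul, norm_mul, norm_pow, norm_pow, pow_succ, ← mul_assoc]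
      gcongr
      exact mul_le_of_le_one_right (norm_nonneg _) (pow_le_one₀ (norm_nonneg q) hq.le)
    · refine norm_qPochInf_le_of_norm_le hq ?_
      rw [mul_assoc, ← pow_add]
      exact norm_mul_pow_le hq _ _
  rw [← tsum_mul_left, tsum_congr e1, ← hs.tsum_comm, residualSeries]
  refine tsum_congr fun k => ?_
  rw [qPhi, ← tsum_mul_left]
  exact tsum_congr fun n => by ring

/-! ### The three-term identity for `0 < |c| < 1`. -/

/-- Reversal of the finite product, pulling `-Bq^{-i}` out of each factor `1 - Bq^{-i}`. -/
theorem qTri_mul_qPoch_mul_zpow {q B : ℂ} (hq0 : q ≠ 0) (hB : B ≠ 0) (y : ℕ) :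
    qTri q y * qPoch (B * q ^ (1 - (y : ℤ))) q y = B ^ y * qPoch B⁻¹ q y := by
  induction y with
  | zero => simp [qTri_zero, qPoch_zero]
  | succ y ih =>
    have h : B * q ^ (1 - ((y + 1 : ℕ) : ℤ)) * q = B * q ^ (1 - (y : ℤ)) := by
      rw [mul_assoc, ← zpow_add_one₀ hq0]
      congr 2
      push_cast
      ring
    have h2 : B * q ^ (1 - ((y + 1 : ℕ) : ℤ)) * q ^ y = B := by
      rw [mul_assoc, ← zpow_natCast q y, ← zpow_add₀ hq0]
      simp
    rw [qPoch_succ', h, qTri_succ, qPoch_succ]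
    calc _ = -(q ^ y * (1 - B * q ^ (1 - ((y + 1 : ℕ) : ℤ)))) *
          (qTri q y * qPoch (B * q ^ (1 - (y : ℤ))) q y) := by ring
      _ = -(q ^ y - B * q ^ (1 - ((y + 1 : ℕ) : ℤ)) * q ^ y) * (B ^ y * qPoch B⁻¹ q y) := by
          rw [ih]; ring
      _ = _ := by rw [h2]; field_simp; ring

theorem qTri_mul_qPochInf_mul_zpow {q B : ℂ} (hq0 : q ≠ 0) (hq : ‖q‖ < 1) (hB : B ≠ 0) (y : ℕ) :
    qTri q y * qPochInf (B * q ^ (1 - (y : ℤ))) q =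
      B ^ y * qPoch B⁻¹ q y * qPochInf (B * q) q := by
  rw [qPochInf_eq_qPoch_mul _ hq y, ← mul_assoc, qTri_mul_qPoch_mul_zpow hq0 hB, mul_assoc B,
    ← zpow_natCast q y, ← zpow_add₀ hq0]
  simp

section

variable {q a c : ℂ}

theorem summable_norm_theta_mul_qPhi_term (hq0 : q ≠ 0) (hq : ‖q‖ < 1) (ha : a ≠ 0) (hc0 : c ≠ 0)
    (hc : ‖c‖ < 1) :
    Summable fun p : ℕ × ℤ => ‖a ^ p.1 * q ^ (p.1 ^ 2 + p.1) / qPoch q q p.1 *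
      (qTriInt q p.2 * (c / a) ^ p.2 * qPochInf (a * q ^ p.1 * q ^ (1 - p.2)) q)‖ := by
  obtain ⟨G, hG, hle⟩ := exists_summable_norm_qTriInt_mul_qPochInf_le hq0 hq
    (div_ne_zero hc0 ha) hc
  have hG0 : ∀ y, 0 ≤ G y := fun y => (norm_nonneg _).trans (hle 0 y (by simp))
  refine .of_nonneg_of_le (fun _ => norm_nonneg _) ?_
    ((summable_norm_pow_mul_pow_sq_div_qPoch hq a).mul_of_nonneg hG (fun _ => norm_nonneg _) hG0)
  rintro ⟨n, y⟩
  have h := hle (c * q ^ n) y (norm_mul_pow_le hq c n)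
  rw [show c * q ^ n / (c / a) = a * q ^ n by field_simp] at h
  rw [norm_mul]
  gcongr

theorem summable_qTriInt_mul_qPhi (hq0 : q ≠ 0) (hq : ‖q‖ < 1) (ha : a ≠ 0) (hc0 : c ≠ 0)
    (hc : ‖c‖ < 1) :
    Summable fun y : ℤ => qTriInt q y * (c / a) ^ y * qPhi a q (q ^ (1 - y)) := by
  have hs := (summable_norm_theta_mul_qPhi_term hq0 hq ha hc0 hc).of_norm.prod_symm.prod
  refine hs.congr fun y => ?_
  rw [qPhi, ← tsum_mul_left]
  exact tsum_congr fun n => by simp only [Prod.swap]; ring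

/-- With the sums interchanged, the sum over `y` is `tsum_qTriInt_mul_qPochInf` with `w = c/a` and
`z = cq^n`. Only `1/(cq^n;q)_∞` depends on `n`, and it supplies `(c;q)_n`. -/
theorem tsum_qTriInt_mul_qPhi (hq0 : q ≠ 0) (hq : ‖q‖ < 1) (ha : a ≠ 0) (hc0 : c ≠ 0)
    (hc : ‖c‖ < 1) :
    ∑' y : ℤ, qTriInt q y * (c / a) ^ y * qPhi a q (q ^ (1 - y)) =
      qPochInf (c / a) q * qPochInf (a * q / c) q * qPochInf q q / qPochInf c q *
        ∑' n : ℕ, qPoch c q n * a ^ n * q ^ (n ^ 2 + n) / qPoch q q n := by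
  have hs : Summable (Function.uncurry fun (n : ℕ) (y : ℤ) =>
      a ^ n * q ^ (n ^ 2 + n) / qPoch q q n *
      (qTriInt q y * (c / a) ^ y * qPochInf (a * q ^ n * q ^ (1 - y)) q)) :=
    (summable_norm_theta_mul_qPhi_term hq0 hq ha hc0 hc).of_norm
  have e1 : ∀ y : ℤ, qTriInt q y * (c / a) ^ y * qPhi a q (q ^ (1 - y)) =
      ∑' n : ℕ, a ^ n * q ^ (n ^ 2 + n) / qPoch q q n *
      (qTriInt q y * (c / a) ^ y * qPochInf (a * q ^ n * q ^ (1 - y)) q) := by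
    intro y
    rw [qPhi, ← tsum_mul_left]
    exact tsum_congr fun n => by ring
  rw [tsum_congr e1, hs.tsum_comm, ← tsum_mul_left]
  refine tsum_congr fun n => ?_
  have hcn : ‖c * q ^ n‖ < 1 := (norm_mul_pow_le hq c n).trans_lt hc
  have e2 := tsum_qTriInt_mul_qPochInf hq0 hq (div_ne_zero hc0 ha) hcn
  rw [show c * q ^ n / (c / a) = a * q ^ n by field_simp,
    show q / (c / a) = a * q / c by field_simp] at e2
  rw [tsum_mul_left, e2, qPochInf_eq_qPoch_mul c hq n]
  have h1 := qPochInf_ne_zero_of_norm_lt_one hq hcn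
  have h2 := qPoch_ne_zero (mul_pow_ne_one_of_norm_lt_one hc hq) n
  field_simp

theorem qPochInf_mul_tsum_eq_tsum_qTri_mul_qPhi (hq0 : q ≠ 0) (hq : ‖q‖ < 1) (ha : a ≠ 0)
    (hc0 : c ≠ 0) (hc : ‖c‖ < 1) :
    qPochInf q q / qPochInf c q * ∑' n : ℕ, qPoch c q (2 * n) * q ^ n / qPoch q q n *
        qPochInf (a * q * q ^ n) q * qPochInf (c / a * q ^ n) q =
      ∑' y : ℕ, qTri q y * (c / a) ^ y * qPhi a q (q ^ (1 - (y : ℤ))) := by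
  have hx : ∀ n : ℕ, (a * q ^ n)⁻¹ * (c * q ^ (2 * n)) = c / a * q ^ n := fun n => by
    rw [two_mul, pow_add]; field_simp
  have hcn : ∀ n : ℕ, ‖c * q ^ n‖ < 1 := fun n => (norm_mul_pow_le hq c n).trans_lt hc
  have hterm : ∀ n y : ℕ, qTri q y * (c / a) ^ y * q ^ (n * y) *
      qPochInf (a * q ^ n * q ^ (1 - (y : ℤ))) q =
      qPoch (a * q ^ n)⁻¹ q y * (c * q ^ (2 * n)) ^ y * qPochInf (a * q * q ^ n) q := by
    intro n y
    have h := qTri_mul_qPochInf_mul_zpow hq0 hq (mul_ne_zero ha (pow_ne_zero n hq0)) y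
    have h2 : (c * q ^ (2 * n)) ^ y = (a * q ^ n) ^ y * ((c / a) ^ y * q ^ (n * y)) := by
      rw [pow_mul q n y, ← mul_pow, ← mul_pow, two_mul, pow_add]
      field_simp
    rw [h2, show a * q * q ^ n = a * q ^ n * q by ring]
    linear_combination (c / a) ^ y * q ^ (n * y) * h
  have hs : Summable (Function.uncurry fun n y : ℕ => qPochInf q q * (q ^ n / qPoch q q n) *
      ((qTri q y * (c / a) ^ y * q ^ (n * y) * qPochInf (a * q ^ n * q ^ (1 - (y : ℤ))) q) /
        qPoch q q y)) := by
    obtain ⟨K, hK0, hK⟩ := exists_norm_inv_qPoch_le hq (mul_pow_ne_one_of_norm_lt_one hq hq)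
    refine Summable.of_norm_bounded
      (((summable_norm_pow_div_qPoch hq hq).mul_of_nonneg
        (summable_geometric_of_lt_one (norm_nonneg c) hc) (fun _ => norm_nonneg _)
        (fun _ => by positivity)).mul_left
        (‖qPochInf q q‖ * Real.exp (‖c / a‖ / ‖c‖ / (1 - ‖q‖)) *
          Real.exp (‖a * q‖ / (1 - ‖q‖)) * K)) ?_
    rintro ⟨n, y⟩
    simp only [Function.uncurry]
    rw [hterm, div_eq_mul_inv (_ * _ * qPochInf _ _), norm_mul, norm_mul (qPochInf q q),
      norm_mul (_ * qPochInf _ _), norm_mul _ (qPochInf (a * q * q ^ n) q)]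
    have h1 := norm_qPoch_mul_pow_le_exp (x := (a * q ^ n)⁻¹) (z := c * q ^ (2 * n)) hq
      (norm_pos_iff.2 hc0) (norm_mul_pow_le hq c _)
      (s := ‖c / a‖) (by rw [hx]; exact norm_mul_pow_le hq _ _) y
    have h2 := norm_qPochInf_le_of_norm_le hq (norm_mul_pow_le hq (a * q) n)
    calc _ ≤ ‖qPochInf q q‖ * ‖q ^ n / qPoch q q n‖ *
          (‖c‖ ^ y * Real.exp (‖c / a‖ / ‖c‖ / (1 - ‖q‖)) *
            Real.exp (‖a * q‖ / (1 - ‖q‖)) * K) := by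
          gcongr
          exact hK _
      _ = _ := by ring
  have e1 : ∀ n : ℕ, qPochInf q q / qPochInf c q * (qPoch c q (2 * n) * q ^ n / qPoch q q n *
        qPochInf (a * q * q ^ n) q * qPochInf (c / a * q ^ n) q) =
      ∑' y : ℕ, qPochInf q q * (q ^ n / qPoch q q n) *
      ((qTri q y * (c / a) ^ y * q ^ (n * y) * qPochInf (a * q ^ n * q ^ (1 - (y : ℤ))) q) /
        qPoch q q y) := by
    intro n
    have e2 : ∀ y : ℕ, qPochInf q q * (q ^ n / qPoch q q n) *
      ((qTri q y * (c / a) ^ y * q ^ (n * y) * qPochInf (a * q ^ n * q ^ (1 - (y : ℤ))) q) /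
        qPoch q q y) = qPochInf q q * (q ^ n / qPoch q q n) * qPochInf (a * q * q ^ n) q *
        (qPoch (a * q ^ n)⁻¹ q y * (c * q ^ (2 * n)) ^ y / qPoch q q y) := by
      intro y
      rw [hterm]
      ring
    rw [tsum_congr e2, tsum_mul_left, tsum_qPoch_mul_pow_div hq (hcn (2 * n)), hx,
      qPochInf_eq_qPoch_mul c hq (2 * n)]
    have h1 := qPochInf_ne_zero_of_norm_lt_one hq (hcn (2 * n))
    have h2 := qPoch_ne_zero (mul_pow_ne_one_of_norm_lt_one hc hq) (2 * n)
    field_simp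
  rw [← tsum_mul_left, tsum_congr e1, ← hs.tsum_comm]
  refine tsum_congr fun y => ?_
  have hz : ‖q * q ^ y‖ < 1 := (norm_mul_pow_le hq q y).trans_lt hq
  -- The choice `z = q^{y+1}` turns the inner sum over `n` into the second form of `qPhi`; here `|z|
  -- < 1` uses `y ≥ 0`.
  have hsz : q ^ (1 - (y : ℤ)) * (q * q ^ y) = q ^ 2 := by
    rw [zpow_sub₀ hq0, zpow_natCast, zpow_one]
    field_simp
  rw [qPhi_eq_qPochInf_mul_tsum hq hz hsz, qPochInf_self_mul hq, ← tsum_mul_left, ← tsum_mul_left]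
  refine tsum_congr fun n => ?_
  rw [mul_pow q, ← pow_mul q y n, mul_comm y n]
  ring

/-- The three-term identity after clearing denominators, for `0 < ‖c‖ < 1`. -/
theorem three_term_of_norm_lt_one (hq0 : q ≠ 0) (hq : ‖q‖ < 1) (ha : a ≠ 0)
    (hc0 : c ≠ 0) (hc : ‖c‖ < 1) :
    ∑' n : ℕ, qPoch c q (2 * n) * q ^ n / qPoch q q n *
        qPochInf (a * q * q ^ n) q * qPochInf (c / a * q ^ n) q =
      qPochInf (c / a) q * qPochInf (a * q / c) q *
        ∑' n : ℕ, qPoch c q n * a ^ n * q ^ (n ^ 2 + n) / qPoch q q n +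
      qPochInf c q / qPochInf q q * residualSeries a q (a * q / c) := by
  have h1 := qPochInf_mul_tsum_eq_tsum_qTri_mul_qPhi hq0 hq ha hc0 hc
  have h2 := tsum_qTriInt_mul_qPhi hq0 hq ha hc0 hc
  have hs := summable_qTriInt_mul_qPhi hq0 hq ha hc0 hc
  obtain ⟨f, hf⟩ : ∃ f : ℤ → ℂ,
      ∀ y, f y = qTriInt q y * (c / a) ^ y * qPhi a q (q ^ (1 - y)) := ⟨_, fun _ => rfl⟩
  simp only [← hf] at h2 hs
  have hsplit : ∑' y : ℤ, f y = ∑' n : ℕ, f n + ∑' n : ℕ, f (-((n : ℤ) + 1)) :=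
    tsum_of_nat_of_neg_add_one (hs.comp_injective Nat.cast_injective)
      (hs.comp_injective (i := fun n : ℕ => -((n : ℤ) + 1)) fun m n h => by simpa using h)
  rw [hsplit] at h2
  have e1 : ∑' n : ℕ, f n =
      ∑' y : ℕ, qTri q y * (c / a) ^ y * qPhi a q (q ^ (1 - (y : ℤ))) :=
    tsum_congr fun n => by rw [hf, qTriInt_natCast hq0, zpow_natCast]
  -- At `y = -(k+1)` the power `(c/a)^y` combines with the Gaussian coefficient into powers of `aq/c
  -- = b`, with one extra sign.
  have e2 : ∑' n : ℕ, f (-((n : ℤ) + 1)) = -residualSeries a q (a * q / c) := by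
    rw [residualSeries, ← tsum_neg]
    refine tsum_congr fun k => ?_
    have h3 := qTriInt_neg hq0 (k + 1)
    rw [Nat.cast_succ] at h3
    rw [hf, h3, qTri_succ, show (1 - (-((k : ℤ) + 1))) = ((k + 2 : ℕ) : ℤ) by push_cast; ring,
      zpow_natCast, show -((k : ℤ) + 1) = -((k + 1 : ℕ) : ℤ) by push_cast; ring, zpow_neg,
      zpow_natCast, ← inv_pow, inv_div, div_pow, div_pow, mul_pow, pow_succ q k]
    field_simp
  rw [e1, e2, ← h1] at h2
  have hc' := qPochInf_ne_zero_of_norm_lt_one hq hc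
  have hq' := qPochInf_ne_zero_of_norm_lt_one hq hq
  generalize (∑' n : ℕ, qPoch c q (2 * n) * q ^ n / qPoch q q n *
    qPochInf (a * q * q ^ n) q * qPochInf (c / a * q ^ n) q) = L at h2 ⊢
  generalize residualSeries a q (a * q / c) = P at h2 ⊢
  generalize (∑' n : ℕ, qPoch c q n * a ^ n * q ^ (n ^ 2 + n) / qPoch q q n) = S at h2 ⊢
  generalize qPochInf (c / a) q = A at h2 ⊢
  generalize qPochInf (a * q / c) q = B at h2 ⊢
  field_simp at h2 ⊢
  linear_combination h2

end

/-! ### Analytic continuation in `c`. -/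

section Continuation

variable {q a : ℂ}

theorem differentiable_qPoch (q : ℂ) (n : ℕ) : Differentiable ℂ fun c => qPoch c q n := by
  unfold qPoch
  fun_prop

theorem norm_qPochInf_le_exp {x q : ℂ} (hq : ‖q‖ < 1) {R : ℝ} (h : ‖x‖ ≤ R) :
    ‖qPochInf x q‖ ≤ Real.exp (R / (1 - ‖q‖)) := by
  refine (norm_qPochInf_le x hq).trans ?_
  have : 0 < 1 - ‖q‖ := sub_pos.2 hq
  gcongr

theorem norm_qPoch_le_exp {x q : ℂ} (hq : ‖q‖ < 1) {R : ℝ} (h : ‖x‖ ≤ R) (n : ℕ) :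
    ‖qPoch x q n‖ ≤ Real.exp (R / (1 - ‖q‖)) := by
  refine (norm_qPoch_le x hq n).trans ?_
  have : 0 < 1 - ‖q‖ := sub_pos.2 hq
  gcongr

theorem differentiable_left_series (hq : ‖q‖ < 1) (a : ℂ) :
    Differentiable ℂ fun c => ∑' n : ℕ, qPoch c q (2 * n) * q ^ n / qPoch q q n *
        qPochInf (a * q * q ^ n) q * qPochInf (c / a * q ^ n) q := by
  refine differentiable_tsum_of_norm_le (fun n => ?_) fun R => ⟨fun n =>
    Real.exp (R / (1 - ‖q‖)) * ‖q ^ n / qPoch q q n‖ * Real.exp (‖a * q‖ / (1 - ‖q‖)) *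
      Real.exp (R / ‖a‖ / (1 - ‖q‖)), ?_, fun n c hc => ?_⟩
  · have h1 := differentiable_qPoch q (2 * n)
    have h2 : Differentiable ℂ fun c => qPochInf (c / a * q ^ n) q :=
      (differentiable_qPochInf hq).comp (by fun_prop : Differentiable ℂ fun c => c / a * q ^ n)
    fun_prop
  · exact (((summable_norm_pow_div_qPoch hq hq).mul_left _).mul_right _).mul_right _
  · beta_reduce
    rw [norm_mul, norm_mul, mul_div_assoc, norm_mul]
    gcongr
    · exact norm_qPoch_le_exp hq hc.le _
    · exact norm_qPochInf_le_exp hq (norm_mul_pow_le hq _ n)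
    · refine norm_qPochInf_le_exp hq ((norm_mul_pow_le hq _ n).trans ?_)
      rw [norm_div]
      gcongr

theorem differentiable_right_series (hq : ‖q‖ < 1) (a : ℂ) :
    Differentiable ℂ fun c => ∑' n : ℕ, qPoch c q n * a ^ n * q ^ (n ^ 2 + n) / qPoch q q n := by
  refine differentiable_tsum_of_norm_le (fun n => ?_) fun R => ⟨fun n =>
    Real.exp (R / (1 - ‖q‖)) * ‖a ^ n * q ^ (n ^ 2 + n) / qPoch q q n‖, ?_, fun n c hc => ?_⟩
  · have h1 := differentiable_qPoch q n
    fun_prop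
  · exact (summable_norm_pow_mul_pow_sq_div_qPoch hq a).mul_left _
  · beta_reduce
    rw [mul_assoc, mul_div_assoc, norm_mul]
    gcongr
    exact norm_qPoch_le_exp hq hc.le _

theorem norm_qPhi_le (hq : ‖q‖ < 1) (a : ℂ) : ∃ M : ℝ, 0 ≤ M ∧ ∀ k : ℕ,
    ‖qPhi a q (q ^ k)‖ ≤ M := by
  refine ⟨_, ?_, fun k => tsum_of_norm_bounded
    ((summable_norm_pow_mul_pow_sq_div_qPoch hq a).mul_right
      (Real.exp (‖a‖ / (1 - ‖q‖)))).hasSum fun n => ?_⟩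
  · exact tsum_nonneg fun n => by positivity
  · rw [mul_div_right_comm, norm_mul]
    gcongr
    refine norm_qPochInf_le_exp hq ?_
    rw [mul_assoc, ← pow_add]
    exact norm_mul_pow_le hq _ _

theorem differentiable_residualSeries (hq : ‖q‖ < 1) (a : ℂ) :
    Differentiable ℂ (residualSeries a q) := by
  obtain ⟨M, hM0, hM⟩ := norm_qPhi_le hq a
  refine differentiable_tsum_of_norm_le (fun n => by fun_prop) fun R => ⟨fun n =>
    ‖qTri q n‖ * R ^ (n + 1) * M, ?_, fun n b hb => ?_⟩
  · exact ((((summable_norm_qTri_mul_pow hq R).mul_right R).mul_right M).congr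
      fun n => by ring)
  · have hR : 0 ≤ R := (norm_nonneg b).trans hb.le
    beta_reduce
    rw [norm_mul, norm_mul, norm_pow, norm_mul]
    gcongr
    · exact mul_le_of_le_one_right (norm_nonneg _) (by
        rw [norm_pow]; exact pow_le_one₀ (norm_nonneg q) hq.le)
    · exact hM _

/-- The three-term identity after clearing denominators. -/
theorem three_term {c : ℂ} (hq0 : q ≠ 0) (hq : ‖q‖ < 1) (ha : a ≠ 0) (hc0 : c ≠ 0) :
    ∑' n : ℕ, qPoch c q (2 * n) * q ^ n / qPoch q q n *
        qPochInf (a * q * q ^ n) q * qPochInf (c / a * q ^ n) q =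
      qPochInf (c / a) q * qPochInf (a * q / c) q *
        ∑' n : ℕ, qPoch c q n * a ^ n * q ^ (n ^ 2 + n) / qPoch q q n +
      qPochInf c q / qPochInf q q * residualSeries a q (a * q / c) := by
  have hU : IsOpen ({0}ᶜ : Set ℂ) := isOpen_compl_singleton
  have hd : DifferentiableOn ℂ (fun c : ℂ => a * q / c) {0}ᶜ := fun c (hc : c ≠ 0) =>
    ((differentiableAt_const (a * q)).div differentiableAt_id (by simpa using hc)).differentiableWithinAt
  have hL := ((differentiable_left_series hq a).differentiableOn (s := {0}ᶜ)).analyticOnNhd hU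
  have hR : DifferentiableOn ℂ (fun c : ℂ => qPochInf (c / a) q * qPochInf (a * q / c) q *
        ∑' n : ℕ, qPoch c q n * a ^ n * q ^ (n ^ 2 + n) / qPoch q q n +
      qPochInf c q / qPochInf q q * residualSeries a q (a * q / c)) {0}ᶜ := by
    have h1 : Differentiable ℂ fun c => qPochInf (c / a) q :=
      (differentiable_qPochInf hq).comp (by fun_prop : Differentiable ℂ fun c => c / a)
    have h2 : DifferentiableOn ℂ (fun c => qPochInf (a * q / c) q) {0}ᶜ :=
      (differentiable_qPochInf hq).comp_differentiableOn hd
    have h3 : DifferentiableOn ℂ (fun c => residualSeries a q (a * q / c)) {0}ᶜ :=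
      (differentiable_residualSeries hq a).comp_differentiableOn hd
    exact ((h1.differentiableOn.mul h2).mul (differentiable_right_series hq a).differentiableOn).add
      (((differentiable_qPochInf hq).div_const _).differentiableOn.mul h3)
  have h0 : (1 / 2 : ℂ) ∈ ({0}ᶜ : Set ℂ) := by norm_num
  refine hL.eqOn_of_preconnected_of_eventuallyEq (hR.analyticOnNhd hU)
    (isConnected_compl_singleton_of_one_lt_rank (by simp) 0).isPreconnected h0 ?_ hc0
  -- Any point of the punctured unit disc would serve: the identity holds near it and `ℂ \ {0}` is
  -- connected.
  have hb : (1 / 2 : ℂ) ∈ Metric.ball (0 : ℂ) 1 := by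
    rw [mem_ball_zero_iff]; norm_num
  filter_upwards [hU.mem_nhds h0, Metric.isOpen_ball.mem_nhds hb] with x hx hx1
  exact three_term_of_norm_lt_one hq0 hq ha hx (by simpa using hx1)

end Continuation

/-! ### Return to `a, b` and the specialization `b = a`. -/

section

variable {q a b : ℂ}

theorem summable_left_series (hq : ‖q‖ < 1) (c : ℂ) (haq : ∀ n : ℕ, a * q * q ^ n ≠ 1)
    (hqb : ∀ n : ℕ, q / b * q ^ n ≠ 1) :
    Summable fun n : ℕ => qPoch c q (2 * n) * q ^ n /
      (qPoch q q n * qPoch (a * q) q n * qPoch (q / b) q n) := by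
  obtain ⟨K₁, h₁, hK₁⟩ := exists_norm_inv_qPoch_le hq haq
  obtain ⟨K₂, h₂, hK₂⟩ := exists_norm_inv_qPoch_le hq hqb
  refine (((summable_norm_pow_div_qPoch hq hq).mul_left
    (Real.exp (‖c‖ / (1 - ‖q‖)))).mul_right (K₁ * K₂)).of_norm_bounded fun n => ?_
  have h : qPoch c q (2 * n) * q ^ n / (qPoch q q n * qPoch (a * q) q n * qPoch (q / b) q n) =
      qPoch c q (2 * n) * (q ^ n / qPoch q q n) *
        ((qPoch (a * q) q n)⁻¹ * (qPoch (q / b) q n)⁻¹) := by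
    rw [div_eq_mul_inv, div_eq_mul_inv, mul_inv, mul_inv]; ring
  rw [h, norm_mul, norm_mul, norm_mul _⁻¹]
  gcongr
  · exact norm_qPoch_le _ hq _
  · exact hK₁ n
  · exact hK₂ n

theorem summable_right_series (hq : ‖q‖ < 1) (c : ℂ) :
    Summable fun n : ℕ => qPoch c q n * a ^ n * q ^ (n ^ 2 + n) / qPoch q q n := by
  refine ((summable_norm_pow_mul_pow_sq_div_qPoch hq a).mul_left
    (Real.exp (‖c‖ / (1 - ‖q‖)))).of_norm_bounded fun n => ?_
  rw [mul_assoc, mul_div_assoc, norm_mul]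
  gcongr
  exact norm_qPoch_le _ hq _

theorem left_series_eq (hq0 : q ≠ 0) (hq : ‖q‖ < 1) (ha : a ≠ 0) (hb : b ≠ 0)
    (haq : ∀ n : ℕ, a * q * q ^ n ≠ 1) (hqb : ∀ n : ℕ, q / b * q ^ n ≠ 1) :
    ∑' n : ℕ, qPoch (a * q / b) q (2 * n) * q ^ n /
        (qPoch q q n * qPoch (a * q) q n * qPoch (q / b) q n) =
      qPochInf b q / qPochInf (a * q) q *
          ∑' n : ℕ, qPoch (a * q / b) q n * a ^ n * q ^ (n ^ 2 + n) / qPoch q q n +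
        qPochInf (a * q / b) q / (qPochInf q q * qPochInf (q / b) q) *
          ∑' n : ℕ, ∑' k : ℕ, doubleTerm a b q n k := by
  have h := three_term (c := a * q / b) hq0 hq ha (div_ne_zero (mul_ne_zero ha hq0) hb)
  rw [show a * q / b / a = q / b by field_simp, show a * q / (a * q / b) = b by field_simp,
    ← qPochInf_mul_tsum_doubleTerm hq0 hq ha haq] at h
  have h1 := qPochInf_ne_zero hq haq
  have h2 := qPochInf_ne_zero hq hqb
  have h3 := qPochInf_ne_zero_of_norm_lt_one hq hq
  have e1 : ∀ n : ℕ, qPoch (a * q / b) q (2 * n) * q ^ n /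
      (qPoch q q n * qPoch (a * q) q n * qPoch (q / b) q n) =
      (qPochInf (a * q) q * qPochInf (q / b) q)⁻¹ *
      (qPoch (a * q / b) q (2 * n) * q ^ n / qPoch q q n * qPochInf (a * q * q ^ n) q *
        qPochInf (q / b * q ^ n) q) := by
    intro n
    have h4 := qPoch_ne_zero haq n
    have h5 := qPoch_ne_zero hqb n
    have h6 := qPoch_self_ne_zero hq n
    have h7 := qPochInf_ne_zero hq (ne_one_shift haq n)
    have h8 := qPochInf_ne_zero hq (ne_one_shift hqb n)
    rw [qPochInf_eq_qPoch_mul (a * q) hq n, qPochInf_eq_qPoch_mul (q / b) hq n]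
    generalize qPochInf (q / b * q ^ n) q = Y at h8 ⊢
    field_simp
  rw [tsum_congr e1, tsum_mul_left, h]
  field_simp

/-- The factor with index `i = n` of `(q^{-n};q)_k` is zero. -/
theorem doubleTerm_self_eq_zero (hq0 : q ≠ 0) (ha : a ≠ 0) {n k : ℕ} (h : n < k) :
    doubleTerm a a q n k = 0 := by
  have h1 : qPoch (a * q ^ (-(n : ℤ)) / a) q k = 0 := by
    refine Finset.prod_eq_zero (Finset.mem_range.2 h) ?_
    rw [zpow_neg, zpow_natCast]
    field_simp
    ring
  rw [doubleTerm, h1]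
  simp

/-- The shift `n = m + k` isolates the dependence on `m` as a term of Cauchy's identity with `u =
aq^{2k+1}`; reversing `(q^{-m-k};q)_k` cancels part of `(q;q)_{m+k}`. -/
theorem qPochInf_mul_doubleTerm_self (hq0 : q ≠ 0) (hq : ‖q‖ < 1) (ha : a ≠ 0)
    (haq : ∀ n : ℕ, a * q * q ^ n ≠ 1) (m k : ℕ) :
    qPochInf (a * q) q * doubleTerm a a q (m + k) k =
      a * (a ^ (3 * k) * q ^ (k * (3 * k + 2)) * (1 - a * q ^ (2 * k + 1))) *
        ((a * q ^ (2 * k + 1)) ^ m * q ^ (m ^ 2) *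
          qPochInf (a * q ^ (2 * k + 1) * q * q ^ m) q / qPoch q q m) := by
  have h1 := qTri_mul_qPoch_mul_zpow hq0 (pow_ne_zero (m + k) hq0) k
  have h2 : q ^ (m + k) * q ^ (1 - (k : ℤ)) = q * q ^ m := by
    rw [← zpow_natCast q (m + k), ← zpow_add₀ hq0, ← zpow_natCast q m, ← zpow_one_add₀ hq0]
    congr 1
    push_cast
    ring
  have h3 : a * q ^ (-((m + k : ℕ) : ℤ)) / a = (q ^ (m + k))⁻¹ := by
    rw [zpow_neg, zpow_natCast, mul_div_cancel_left₀ _ ha]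
  have h4 : qTri q k ^ 4 * q ^ (2 * k) = q ^ (2 * k ^ 2) := by
    rw [two_mul (k ^ 2), pow_add, ← qTri_mul_self]; ring
  have h5 := qPoch_ne_zero haq (m + k + k + 1)
  have h6 := qPoch_self_ne_zero hq m
  have h7 := qPoch_ne_zero (ne_one_shift (mul_pow_ne_one_of_norm_lt_one hq hq) m) k
  rw [h2] at h1
  rw [doubleTerm_eq, h3, qPochInf_eq_qPoch_mul (a * q) hq (m + k + k + 1), qPoch_add q q m k,
    show a * q * q ^ (m + k + k + 1) = a * q ^ (2 * k + 1) * q * q ^ m by ring]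
  have h8 : qPoch (q ^ (m + k))⁻¹ q k * (a * a * q ^ (m + k + 3)) ^ k * qTri q k ^ 3 =
      qPoch (q * q ^ m) q k * (a ^ (2 * k) * q ^ k * q ^ (2 * k ^ 2)) := by
    rw [← h4]
    calc _ = (q ^ (m + k)) ^ k * qPoch (q ^ (m + k))⁻¹ q k * (a * a * q ^ 3) ^ k *
          qTri q k ^ 3 := by ring
      _ = _ := by rw [← h1]; ring
  rw [h8]
  field_simp
  ring

theorem qPochInf_mul_tsum_doubleTerm_self (hq0 : q ≠ 0) (hq : ‖q‖ < 1) (ha : a ≠ 0)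
    (haq : ∀ n : ℕ, a * q * q ^ n ≠ 1) :
    qPochInf (a * q) q * ∑' n : ℕ, ∑' k : ℕ, doubleTerm a a q n k =
      a * ∑' n : ℕ, a ^ (3 * n) * q ^ (n * (3 * n + 2)) * (1 - a * q ^ (2 * n + 1)) := by
  have hs : Summable (Function.uncurry fun n k : ℕ => doubleTerm a a q n k) :=
    (summable_norm_doubleTerm hq0 hq ha haq).of_norm
  rw [← hs.tsum_comm, ← tsum_mul_left, ← tsum_mul_left]
  refine tsum_congr fun k => ?_
  have hk : Summable fun n : ℕ => doubleTerm a a q n k := hs.prod_symm.prod_factor k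
  rw [← hk.sum_add_tsum_nat_add k, Finset.sum_eq_zero fun n hn =>
    doubleTerm_self_eq_zero hq0 ha (Finset.mem_range.1 hn), zero_add, ← tsum_mul_left,
    tsum_congr fun m => qPochInf_mul_doubleTerm_self hq0 hq ha haq m k, tsum_mul_left,
    tsum_pow_sq_mul_qPochInf hq, mul_one]

theorem summable_pow_mul_pow_sq_add (hq : ‖q‖ < 1) (a : ℂ) :
    Summable fun n : ℕ => a ^ n * q ^ (n ^ 2 + n) := by
  refine (summable_norm_qTri_mul_pow hq ‖a‖).of_norm_bounded fun n => ?_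
  rw [norm_mul, norm_pow, mul_comm]
  gcongr
  exact norm_pow_sq_add_le hq n

theorem summable_partialTheta (hq : ‖q‖ < 1) (a : ℂ) :
    Summable fun n : ℕ => a ^ (3 * n) * q ^ (n * (3 * n + 2)) * (1 - a * q ^ (2 * n + 1)) := by
  refine ((summable_norm_qTri_mul_pow hq (‖a‖ ^ 3)).mul_right
    (1 + ‖a‖)).of_norm_bounded fun n => ?_
  rw [norm_mul, norm_mul, norm_pow, mul_comm (‖a‖ ^ _), pow_mul ‖a‖]
  gcongr
  · rw [show n * (3 * n + 2) = n ^ 2 + n + (2 * n ^ 2 + n) by ring, pow_add q (n ^ 2 + n)]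
    exact (norm_mul_pow_le hq _ _).trans (norm_pow_sq_add_le hq n)
  · refine (norm_sub_le _ _).trans ?_
    rw [norm_one]
    gcongr
    exact norm_mul_pow_le hq _ _

theorem qPoch_two_mul_div (hq : ‖q‖ < 1) (n : ℕ) (x y : ℂ) :
    qPoch q q (2 * n) * q ^ n / (qPoch q q n * x * y) =
      qPoch (q ^ (n + 1)) q n * q ^ n / (x * y) := by
  rw [two_mul, qPoch_add, ← pow_succ', mul_assoc, mul_assoc (qPoch q q n) x y]
  exact mul_div_mul_left _ _ (qPoch_self_ne_zero hq n)

end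

theorem mainTheorem4 (q a b : ℂ) (hq0 : q ≠ 0) (hq1 : ‖q‖ < 1) (ha : a ≠ 0) (hb : b ≠ 0)
    (haq : ∀ n : ℕ, a * q ^ (n + 1) ≠ 1) (hbq : ∀ n : ℕ, b ≠ q ^ (n + 1)) :
    -- the three-term identity, all series converging absolutely
    (Summable (fun n : ℕ =>
        qPoch (a * q / b) q (2 * n) * q ^ n /
          (qPoch q q n * qPoch (a * q) q n * qPoch (q / b) q n)) ∧
      Summable (fun n : ℕ =>
        qPoch (a * q / b) q n * a ^ n * q ^ (n ^ 2 + n) / qPoch q q n) ∧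
      Summable (fun p : ℕ × ℕ =>
        (-1) ^ p.2 * qPoch (b * q ^ (-(p.1 : ℤ)) / a) q p.2 * a ^ (p.1 + p.2) * b ^ (p.2 + 1) *
            q ^ (p.1 ^ 2 + p.1 + p.1 * p.2 + 3 * p.2 * (p.2 + 1) / 2) *
            (1 - b * q ^ (2 * p.2 + 1)) /
          (qPoch q q p.1 * qPoch (a * q) q (p.1 + p.2 + 1))) ∧
      ∑' n : ℕ, qPoch (a * q / b) q (2 * n) * q ^ n /
          (qPoch q q n * qPoch (a * q) q n * qPoch (q / b) q n) =
        qPochInf b q / qPochInf (a * q) q *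
            ∑' n : ℕ, qPoch (a * q / b) q n * a ^ n * q ^ (n ^ 2 + n) / qPoch q q n +
          qPochInf (a * q / b) q / (qPochInf q q * qPochInf (q / b) q) *
            ∑' n : ℕ, ∑' k : ℕ,
              (-1) ^ k * qPoch (b * q ^ (-(n : ℤ)) / a) q k * a ^ (n + k) * b ^ (k + 1) *
                  q ^ (n ^ 2 + n + n * k + 3 * k * (k + 1) / 2) *
                  (1 - b * q ^ (2 * k + 1)) /
                (qPoch q q n * qPoch (a * q) q (n + k + 1))) ∧
    -- for `b = a` it reduces, term by term, to Ramanujan's identity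
    (b = a →
      (∀ n : ℕ, qPoch (a * q / b) q (2 * n) * q ^ n /
            (qPoch q q n * qPoch (a * q) q n * qPoch (q / b) q n) =
          qPoch (q ^ (n + 1)) q n * q ^ n / (qPoch (a * q) q n * qPoch (q / a) q n)) ∧
      qPochInf b q / qPochInf (a * q) q *
            ∑' n : ℕ, qPoch (a * q / b) q n * a ^ n * q ^ (n ^ 2 + n) / qPoch q q n =
          (1 - a) * ∑' n : ℕ, a ^ n * q ^ (n ^ 2 + n) ∧
      qPochInf (a * q / b) q / (qPochInf q q * qPochInf (q / b) q) *
            ∑' n : ℕ, ∑' k : ℕ,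
              (-1) ^ k * qPoch (b * q ^ (-(n : ℤ)) / a) q k * a ^ (n + k) * b ^ (k + 1) *
                  q ^ (n ^ 2 + n + n * k + 3 * k * (k + 1) / 2) *
                  (1 - b * q ^ (2 * k + 1)) /
                (qPoch q q n * qPoch (a * q) q (n + k + 1)) =
          a / (qPochInf (a * q) q * qPochInf (q / a) q) *
            ∑' n : ℕ, a ^ (3 * n) * q ^ (n * (3 * n + 2)) * (1 - a * q ^ (2 * n + 1)) ∧
      Summable (fun n : ℕ =>
          qPoch (q ^ (n + 1)) q n * q ^ n / (qPoch (a * q) q n * qPoch (q / a) q n)) ∧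
      Summable (fun n : ℕ => a ^ n * q ^ (n ^ 2 + n)) ∧
      Summable (fun n : ℕ =>
          a ^ (3 * n) * q ^ (n * (3 * n + 2)) * (1 - a * q ^ (2 * n + 1))) ∧
      ∑' n : ℕ, qPoch (q ^ (n + 1)) q n * q ^ n / (qPoch (a * q) q n * qPoch (q / a) q n) =
        (1 - a) * ∑' n : ℕ, a ^ n * q ^ (n ^ 2 + n) +
          a / (qPochInf (a * q) q * qPochInf (q / a) q) *
            ∑' n : ℕ, a ^ (3 * n) * q ^ (n * (3 * n + 2)) * (1 - a * q ^ (2 * n + 1))) := by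
  have haq' : ∀ n : ℕ, a * q * q ^ n ≠ 1 := fun n => by
    rw [mul_assoc, ← pow_succ']; exact haq n
  have hqb : ∀ n : ℕ, q / b * q ^ n ≠ 1 := fun n h => hbq n <| by
    field_simp at h
    rw [pow_succ', h]
  have hmain := left_series_eq hq0 hq1 ha hb haq' hqb
  refine ⟨⟨summable_left_series hq1 _ haq' hqb, summable_right_series hq1 _,
    (summable_norm_doubleTerm hq0 hq1 ha haq').of_norm, hmain⟩, ?_⟩
  -- The substitution eliminates `a`, so Ramanujan's parameter is called `b` from here on.
  rintro rfl
  have hc : b * q / b = q := mul_div_cancel_left₀ q hb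
  have h1 := qPochInf_ne_zero hq1 haq'
  have h3 := qPochInf_ne_zero_of_norm_lt_one hq1 hq1
  have hterm : ∀ n : ℕ, qPoch (b * q / b) q (2 * n) * q ^ n /
      (qPoch q q n * qPoch (b * q) q n * qPoch (q / b) q n) =
      qPoch (q ^ (n + 1)) q n * q ^ n / (qPoch (b * q) q n * qPoch (q / b) q n) := fun n => by
    rw [hc, qPoch_two_mul_div hq1]
  have hfirst : qPochInf b q / qPochInf (b * q) q *
      ∑' n : ℕ, qPoch (b * q / b) q n * b ^ n * q ^ (n ^ 2 + n) / qPoch q q n =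
      (1 - b) * ∑' n : ℕ, b ^ n * q ^ (n ^ 2 + n) := by
    rw [qPochInf_eq_one_sub_mul b hq1, mul_div_cancel_right₀ _ h1, hc]
    congr 1
    refine tsum_congr fun n => ?_
    rw [mul_assoc, mul_div_cancel_left₀ _ (qPoch_self_ne_zero hq1 n)]
  have hsecond : qPochInf (b * q / b) q / (qPochInf q q * qPochInf (q / b) q) *
      ∑' n : ℕ, ∑' k : ℕ, doubleTerm b b q n k =
      b / (qPochInf (b * q) q * qPochInf (q / b) q) *
        ∑' n : ℕ, b ^ (3 * n) * q ^ (n * (3 * n + 2)) * (1 - b * q ^ (2 * n + 1)) := by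
    have h2 := qPochInf_ne_zero hq1 hqb
    have key := qPochInf_mul_tsum_doubleTerm_self hq0 hq1 ha haq'
    rw [hc, div_mul_eq_mul_div b, ← key]
    generalize qPochInf (b * q) q = X at h1 ⊢
    field_simp
  simp only [doubleTerm] at hmain hsecond
  refine ⟨hterm, hfirst, hsecond, ?_, summable_pow_mul_pow_sq_add hq1 b,
    summable_partialTheta hq1 b, ?_⟩
  · exact (summable_left_series hq1 _ haq' hqb).congr hterm
  · exact (tsum_congr hterm).symm.trans (hmain.trans (congrArg₂ HAdd.hAdd hfirst hsecond))
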